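/- Let $1<\alpha\le 2$, $\sigma>0$ and $T>0$. Notation. Let $C_I(\mathbb R)$ be the set of all $(b-a)$-periodic functions (for some $a<b$) that on $(a,b)$ agree with a function $g\in C[a,b]$, $\int_a^b g=0$, and take the value $\frac{g(a)+g(b)}2$ at $a$. For $f=f_0+c$ with $f_0\in C_I(\mathbb R)$ and $c$ constant, the Riesz derivative is $$\partial^\alpha_{|x|}f(x)=-\frac{\sigma}{2\cos(\alpha\pi/2)}\Big(\frac{d^2}{dx^2}I_-f_0(x)+\frac{d^2}{dx^2}I_+f_0(x)\Big),$$ where both second derivatives have to exist and $$I_-f_0(x)=\frac1{\Gamma(2-\alpha)}\int_{-\infty}^x\frac{f_0(s)}{(x-s)^{\alpha-1}}\,ds,\qquad I_+f_0(x)=\frac1{\Gamma(2-\alpha)}\int_x^{\infty}\frac{f_0(s)}{(s-x)^{\alpha-1}}\,ds$$ are understood as improper integrals; for $\alpha=2$, $I_-f_0=I_+f_0=f_0$, so that $\partial^2_{|x|}f=\sigma f''$. For $w:[0,1]\to\mathbb R$ let $\hat w^{\mathcal N}:\mathbb R\to\mathbb R$ be its even, 2-periodic (Neumann) extension. A (classical)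 solution of the problem $$\partial_t u(t,x)=\partial^\alpha_{|x|}\,\widehat{u(t,\cdot)}^{\mathcal N}(x),\quad t\in(0,T),\ x\in(0,1),\qquad u(0,\cdot)=u_0 \tag{1}$$ is a continuous function $u$ on $[0,T)\times[0,1]$ with $u(0,\cdot)=u_0$ such that $\partial^\alpha_{|x|}\widehat{u(t,\cdot)}^{\mathcal N}(x)$ exists for all $t\in(0,T)$, $x\in\mathbb R$ and is continuous in $(t,x)$ there, and $\partial_tu(t,x)$ exists and equals it for all $t\in(0,T)$, $x\in(0,1)$. A (classical, spatially periodic) solution of the Cauchy problem $$\partial_t U=\partial^\alpha_{|x|}U\ \text{ on }(0,T)\times\mathbb R,\qquad U(0,\cdot)=\hat u_0^{\mathcal N} \tag{2}$$ is a continuous function $U$ on $[0,T)\times\mathbb R$ that is periodic in $x$ with some period $p>0$ independent of $t$, attains the initial value, and for which $\partial_tU$ and $\partial^\alpha_{|x|}U$ exist, are equal and are continuous on $(0,T)\times\mathbb R$. Theorem. For every $u_0\in C[0,1]$ the problem (1) is well-posed: it has exactly one solution $u$, and $u$ depends continuously on the initial value, i.e. for every $\varepsilon>0$ there is $\delta>0$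 such that for each $v_0\in C[0,1]$ with $\max_{[0,1]}|v_0-u_0|\le\delta$, every solution $v$ of (1) with initial value $v_0$ satisfies $|v-u|\le\varepsilon$ on $[0,T)\times[0,1]$. For every $t\in(0,T)$ we have $u(t,\cdot)\in C^\infty[0,1]$ and $\partial_xu(t,0)=\partial_xu(t,1)=0$ (one-sided derivatives). Moreover, (2) has exactly one solution $U$; for all $t\in[0,T)$ the function $U(t,\cdot)$ is even and 2-periodic, and $u$ is the restriction of $U$ to $[0,T)\times[0,1]$. -/

import Mathlib

open Set Filter Topology
open scoped ContDiff

/-- Left-sided fractional integral of order `β` with base point `-∞`: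
`I = (1 / Γ(β)) ∫_{-∞}^x f(s) / (x - s)^(1 - β) ds`, for `β > 0`.
The integral over `(-∞, x)` is the improper one, the limit of the integrals over `(A, x)` as
`A → -∞` (for periodic `f` it does not converge absolutely).
The fractional integral of order `0` is the identity. -/
def HasLeftFracIntegral (β : ℝ) (f : ℝ → ℝ) (x I : ℝ) : Prop :=
  (β = 0 ∧ I = f x) ∨
  (0 < β ∧ Tendsto (fun A : ℝ => 1 / Real.Gamma β * ∫ s in A..x, f s / (x - s) ^ (1 - β))
    atBot (𝓝 I))

/-- Right-sided fractional integral of order `β` with base point `∞`: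
`I = (1 / Γ(β)) ∫_x^∞ f(s) / (s - x)^(1 - β) ds`, with the same conventions. -/
def HasRightFracIntegral (β : ℝ) (f : ℝ → ℝ) (x I : ℝ) : Prop :=
  (β = 0 ∧ I = f x) ∨
  (0 < β ∧ Tendsto (fun A : ℝ => 1 / Real.Gamma β * ∫ s in x..A, f s / (s - x) ^ (1 - β))
    atTop (𝓝 I))

/-- `g` is twice differentiable at `x`, with second derivative `d`. -/
def HasSecondDerivAt (g : ℝ → ℝ) (d x : ℝ) : Prop :=
  ∃ g' : ℝ → ℝ, (∀ᶠ y in 𝓝 x, HasDerivAt g (g' y) y) ∧ HasDerivAt g' d x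

/-- The left-sided Riemann-Liouville derivative of order `α ∈ (1, 2]` of `f` at `x` exists and
equals `d`: the second derivative of the left-sided fractional integral of order `2 - α`. -/
def HasLeftRLDerivAt (α : ℝ) (f : ℝ → ℝ) (d x : ℝ) : Prop :=
  ∃ I : ℝ → ℝ, (∀ y, HasLeftFracIntegral (2 - α) f y (I y)) ∧ HasSecondDerivAt I d x

/-- The right-sided Riemann-Liouville derivative of order `α ∈ (1, 2]` of `f` at `x` exists and
equals `d` (the sign `(-1) ^ 2` is `1`). -/
def HasRightRLDerivAt (α : ℝ) (f : ℝ → ℝ) (d x : ℝ) : Prop :=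
  ∃ I : ℝ → ℝ, (∀ y, HasRightFracIntegral (2 - α) f y (I y)) ∧ HasSecondDerivAt I d x

/-- The space `C_I(ℝ)`: `(b - a)`-periodic extensions of restrictions to `(a, b)` of continuous
functions `g` on `[a, b]` with zero integral, with the value `(g a + g b) / 2` at the points
`a + k (b - a)`. -/
def MemCI (f : ℝ → ℝ) : Prop :=
  ∃ a b : ℝ, a < b ∧ Function.Periodic f (b - a) ∧
    ∃ g : ℝ → ℝ, ContinuousOn g (Icc a b) ∧ EqOn f g (Ioo a b) ∧ f a = (g a + g b) / 2 ∧
      ∫ s in a..b, g s = 0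

/-- The Riesz derivative of order `α ∈ (1, 2]` with intensity `σ > 0` of `f = f₀ + c`, where
`f₀ ∈ C_I(ℝ)` and `c` is a constant, exists at `x` and equals `d`. -/
def HasRieszDerivAt (α σ : ℝ) (f : ℝ → ℝ) (d x : ℝ) : Prop :=
  ∃ (f₀ : ℝ → ℝ) (c : ℝ), MemCI f₀ ∧ (∀ y, f y = f₀ y + c) ∧
    ∃ l r : ℝ, HasLeftRLDerivAt α f₀ l x ∧ HasRightRLDerivAt α f₀ r x ∧
      d = -(σ / (2 * Real.cos (α * (Real.pi / 2)))) * (l + r)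

/-- The even, 2-periodic (Neumann type) extension of a function on `[0, 1]`; only the values of
`w` on `[0, 1]` are used, since `x - 2 * round (x / 2)` is the representative of `x` modulo `2`
in `[-1, 1)`. -/
noncomputable def neumannExt (w : ℝ → ℝ) (x : ℝ) : ℝ :=
  w |x - 2 * (round (x / 2) : ℝ)|

/-- `u` is a classical solution of
`∂ₜ u(t, x) = ∂^α_{|x|} (u(t, ·)^N)(x)`, `t ∈ (0, T)`, `x ∈ (0, 1)`, with `u(0, ·) = u₀`.
Here `u` is continuous on `[0, T) × [0, 1]` and the Riesz derivative `D` of the Neumann type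
extension makes sense on the whole line, as a continuous function of `(t, x)`. Only the values of
`u` on `[0, T) × [0, 1]` matter. -/
structure IsNeumannSolution (α σ T : ℝ) (u₀ : ℝ → ℝ) (u : ℝ → ℝ → ℝ) : Prop where
  continuousOn : ContinuousOn (Function.uncurry u) (Ico 0 T ×ˢ Icc 0 1)
  equation : ∃ D : ℝ → ℝ → ℝ,
    ContinuousOn (Function.uncurry D) (Ioo 0 T ×ˢ univ) ∧
    (∀ t ∈ Ioo 0 T, ∀ x : ℝ, HasRieszDerivAt α σ (neumannExt (u t)) (D t x) x) ∧
    (∀ t ∈ Ioo 0 T, ∀ x ∈ Ioo (0 : ℝ) 1, HasDerivAt (fun s => u s x) (D t x) t)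
  initial : ∀ x ∈ Icc (0 : ℝ) 1, u 0 x = u₀ x

/-- `U` is a classical solution, periodic in space with some period, of the Cauchy problem
`∂ₜ U(t, x) = ∂^α_{|x|} U(t, x)`, `t ∈ (0, T)`, `x ∈ ℝ`, with `U(0, ·) = w₀`. -/
structure IsCauchySolution (α σ T : ℝ) (w₀ : ℝ → ℝ) (U : ℝ → ℝ → ℝ) : Prop where
  periodic : ∃ p : ℝ, 0 < p ∧ ∀ t ∈ Ico 0 T, Function.Periodic (U t) p
  continuousOn : ContinuousOn (Function.uncurry U) (Ico 0 T ×ˢ univ)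
  equation : ∃ D : ℝ → ℝ → ℝ,
    ContinuousOn (Function.uncurry D) (Ioo 0 T ×ˢ univ) ∧
    (∀ t ∈ Ioo 0 T, ∀ x : ℝ, HasRieszDerivAt α σ (U t) (D t x) x ∧
      HasDerivAt (fun s => U s x) (D t x) t)
  initial : ∀ x : ℝ, U 0 x = w₀ x

open MeasureTheory intervalIntegral

/-! ### Oscillatory integrals with a power weight -/

/-! On periodic functions the Riesz derivative is a Fourier multiplier. With `β = 2 - α`, the left
fractional integral multiplies a wave of frequency `ν` by `ρ * ν ^ (-β)` and delays its phase by
`θ`; the right one advances the phase by `θ`. In the sum the phases combine to the factor `2 * cos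
θ` and two derivatives contribute `-ν ^ 2`, so the eigenvalue is `-μ * ν ^ α` with `μ = rieszSpeed α
σ ρ θ`. The constants are never evaluated: `0 < ρ * cos θ` is enough for `0 < μ`, and it comes from
the positivity of the integral of `cos s / s ^ (1 - β)` (`exists_isFracMultiplier`). All these
integrals converge only conditionally, so they are truncated at `R` and estimated uniformly in `R`.

Uniqueness: the multiplier is transferred to the test waves (`integral_riesz_mul_cos`), so each
Fourier coefficient of a solution obeys a linear scalar ODE and is fixed by its initial value; a
continuous periodic function is determined by its coefficients (`IsPeriodicEvolution.unique`). The
Neumann extension of a solution of (1) is such an evolution, except perhaps at the integers, which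
form a null set. A solution of (2) may come with a period other than 2; the flow inherits every
period of the initial value, so the comparison takes place over that period.

Existence: the cosine series with factors `exp (-t * μ * (n * π) ^ α)` converges rapidly for `0 <
t`, so it is smooth and can be treated termwise. The hard point is continuity at `t = 0` for merely
continuous data. It follows, like stability, from contractivity in the maximum norm
(`abs_neumannFlow_le`). For cosine polynomials the generator obeys a maximum principle, because `ν ^
α` is a positive superposition of `1 - cos (ν * r)`; hence its resolvents are one-sided
contractions, hence so is their limit, the exponential. Weierstrass approximation extends this to
continuous data. -/

theorem intervalIntegrable_inv_rpow {β : ℝ} (hβ : 0 < β) {a b : ℝ} (ha : 0 ≤ a) (hb : 0 ≤ b) :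
    IntervalIntegrable (fun s : ℝ => (s ^ (1 - β))⁻¹) volume a b := by
  refine (intervalIntegrable_rpow' (r := β - 1) (by linarith)).congr ?_
  intro s hs
  have hs' : 0 ≤ s := le_trans (le_min ha hb) hs.1.le
  change s ^ (β - 1) = (s ^ (1 - β))⁻¹
  rw [← Real.rpow_neg hs']; ring_nf

theorem intervalIntegrable_div_rpow {β : ℝ} (hβ : 0 < β) {f : ℝ → ℝ} (hf : Continuous f)
    {a b : ℝ} (ha : 0 ≤ a) (hb : 0 ≤ b) :
    IntervalIntegrable (fun s => f s / s ^ (1 - β)) volume a b := by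
  simpa only [div_eq_mul_inv] using
    (intervalIntegrable_inv_rpow hβ ha hb).continuousOn_mul hf.continuousOn

/-- Quantitative Dirichlet test. After integration by parts against the decreasing weight, the
boundary term costs `B * R' ^ (β - 1)` and the remaining integral `B * (R ^ (β - 1) - R' ^ (β -
1))`, so `R'` cancels. -/
theorem abs_integral_div_rpow_le {β : ℝ} (hβ1 : β < 1) {f : ℝ → ℝ}
    (hf : Continuous f) {B R R' : ℝ} (hR : 0 < R) (hRR' : R ≤ R')
    (hB : ∀ s, |∫ y in R..s, f y| ≤ B) :
    |∫ s in R..R', f s / s ^ (1 - β)| ≤ B / R ^ (1 - β) := by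
  set G : ℝ → ℝ := fun s => ∫ y in R..s, f y with hG
  have hpos : ∀ s ∈ uIcc R R', 0 < s := fun s hs => by
    rw [uIcc_of_le hRR'] at hs; exact hR.trans_le hs.1
  have hu : ∀ s ∈ uIcc R R', HasDerivAt (fun s : ℝ => s ^ (β - 1)) ((β - 1) * s ^ (β - 1 - 1)) s :=
    fun s hs => Real.hasDerivAt_rpow_const (Or.inl (hpos s hs).ne')
  have hv : ∀ s ∈ uIcc R R', HasDerivAt G (f s) s := fun s _ =>
    integral_hasDerivAt_right (hf.intervalIntegrable _ _) (hf.stronglyMeasurableAtFilter _ _)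
      hf.continuousAt
  have hGc : Continuous G := continuous_primitive (fun a b => hf.intervalIntegrable a b) R
  have hu' : IntervalIntegrable (fun s : ℝ => (β - 1) * s ^ (β - 1 - 1)) volume R R' := by
    apply ContinuousOn.intervalIntegrable
    exact fun s hs => ((Real.continuousAt_rpow_const s _
      (Or.inl (hpos s hs).ne')).continuousWithinAt).const_mul _
  have hparts := integral_mul_deriv_eq_deriv_mul hu hv hu' (hf.intervalIntegrable _ _)
  have hcongr : ∫ s in R..R', f s / s ^ (1 - β) = ∫ s in R..R', s ^ (β - 1) * f s := by
    refine integral_congr fun s hs => ?_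
    rw [show β - 1 = -(1 - β) by ring, Real.rpow_neg (hpos s hs).le, div_eq_mul_inv, mul_comm]
  have hB0 : 0 ≤ B := le_trans (abs_nonneg _) (hB R)
  have hI : |∫ s in R..R', (β - 1) * s ^ (β - 1 - 1) * G s| ≤
      B * (R ^ (β - 1) - R' ^ (β - 1)) := by
    have h1 : ∫ s in R..R', -B * ((β - 1) * s ^ (β - 1 - 1)) =
        B * (R ^ (β - 1) - R' ^ (β - 1)) := by
      rw [intervalIntegral.integral_const_mul, integral_eq_sub_of_hasDerivAt hu hu']; ring
    rw [← h1]
    refine abs_integral_le_integral_abs hRR' |>.trans ?_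
    refine integral_mono_on hRR' ?_ (hu'.const_mul _) ?_
    · exact (hu'.mul_continuousOn hGc.continuousOn).abs
    · intro s hs
      have hs0 : 0 < s := hpos s (by rwa [uIcc_of_le hRR'])
      have h2 : (β - 1) * s ^ (β - 1 - 1) ≤ 0 :=
        mul_nonpos_of_nonpos_of_nonneg (by linarith) (Real.rpow_nonneg hs0.le _)
      rw [abs_mul, abs_of_nonpos h2]
      nlinarith [hB s]
  have hGR : G R = 0 := by simp [hG]
  rw [hcongr, hparts, hGR, mul_zero, sub_zero]
  have h3 : |R' ^ (β - 1) * G R'| ≤ R' ^ (β - 1) * B := by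
    rw [abs_mul, abs_of_nonneg (Real.rpow_nonneg (hR.le.trans hRR') _)]
    exact mul_le_mul_of_nonneg_left (hB R') (Real.rpow_nonneg (hR.le.trans hRR') _)
  have h4 : B / R ^ (1 - β) = B * R ^ (β - 1) := by
    rw [show β - 1 = -(1 - β) by ring, Real.rpow_neg hR.le, div_eq_mul_inv]
  rw [h4]
  refine (abs_sub _ _).trans ?_
  nlinarith

/-- If `f` is bounded and has a bounded primitive, the integrals of `f s / s ^ (1 - β)` over
`(0, R)` are bounded uniformly in `R`. -/
theorem abs_integral_zero_div_rpow_le {β : ℝ} (hβ : 0 < β) (hβ1 : β < 1) {f : ℝ → ℝ}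
    (hf : Continuous f) {M B R : ℝ} (hM : ∀ s, |f s| ≤ M) (hR : 0 ≤ R)
    (hB : ∀ r s, |∫ y in r..s, f y| ≤ B) :
    |∫ s in (0 : ℝ)..R, f s / s ^ (1 - β)| ≤ M / β + B := by
  have hM0 : 0 ≤ M := (abs_nonneg _).trans (hM 0)
  have hB0 : 0 ≤ B := (abs_nonneg _).trans (hB 0 0)
  have hsmall : ∀ r, 0 ≤ r → r ≤ 1 → |∫ s in (0 : ℝ)..r, f s / s ^ (1 - β)| ≤ M / β := by
    intro r hr hr1
    have hint : ∫ s in (0 : ℝ)..r, s ^ (β - 1) = r ^ β / β := by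
      rw [integral_rpow (Or.inl (by linarith))]
      simp [Real.zero_rpow hβ.ne']
    have h1 : ∫ s in (0 : ℝ)..r, M * s ^ (β - 1) ≤ M / β := by
      rw [intervalIntegral.integral_const_mul, hint, ← mul_div_assoc]
      gcongr
      exact mul_le_of_le_one_right hM0 (Real.rpow_le_one hr hr1 hβ.le)
    refine (abs_integral_le_integral_abs hr).trans (le_trans ?_ h1)
    refine integral_mono_on hr (intervalIntegrable_div_rpow hβ hf le_rfl hr).abs
      ((intervalIntegrable_rpow' (by linarith)).const_mul _) fun s hs => ?_
    rw [show β - 1 = -(1 - β) by ring, Real.rpow_neg hs.1, abs_div,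
      abs_of_nonneg (Real.rpow_nonneg hs.1 _), div_eq_mul_inv]
    exact mul_le_mul_of_nonneg_right (hM s) (inv_nonneg.2 (Real.rpow_nonneg hs.1 _))
  -- On `(0, 1)` the weight is integrable and boundedness of `f` suffices; beyond `1` the bounded
  -- primitive is used.
  rcases le_total R 1 with h | h
  · linarith [hsmall R hR h]
  · rw [← integral_add_adjacent_intervals
      (intervalIntegrable_div_rpow hβ hf le_rfl zero_le_one)
      (intervalIntegrable_div_rpow hβ hf zero_le_one hR)]
    refine (abs_add_le _ _).trans (add_le_add (hsmall 1 zero_le_one le_rfl) ?_)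
    simpa using abs_integral_div_rpow_le hβ1 hf one_pos h (hB 1)

theorem exists_tendsto_integral_div_rpow {β : ℝ} (hβ : 0 < β) (hβ1 : β < 1) {f : ℝ → ℝ}
    (hf : Continuous f) {B : ℝ} (hB : ∀ r s, |∫ y in r..s, f y| ≤ B) :
    ∃ L, Tendsto (fun R => ∫ s in (0 : ℝ)..R, f s / s ^ (1 - β)) atTop (𝓝 L) := by
  apply cauchySeq_tendsto_of_complete
  rw [Metric.cauchySeq_iff']
  intro ε hε
  have hlim : Tendsto (fun R : ℝ => B / R ^ (1 - β)) atTop (𝓝 0) :=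
    (tendsto_rpow_atTop (by linarith : 0 < 1 - β)).const_div_atTop B
  obtain ⟨N, hN1, hN⟩ := ((hlim.eventually (gt_mem_nhds hε)).and
    (eventually_gt_atTop 0)).exists
  refine ⟨N, fun n hn => ?_⟩
  rw [Real.dist_eq, ← integral_add_adjacent_intervals
      (intervalIntegrable_div_rpow hβ hf le_rfl hN.le)
      (intervalIntegrable_div_rpow hβ hf hN.le (hN.le.trans hn)), add_sub_cancel_left]
  exact (abs_integral_div_rpow_le hβ1 hf hN hn (hB N)).trans_lt hN1

theorem abs_integral_cos_le {ν : ℝ} (hν : 0 < ν) (ψ r s : ℝ) :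
    |∫ y in r..s, Real.cos (ν * y + ψ)| ≤ 2 / ν := by
  have h := integral_comp_mul_add (a := r) (b := s) Real.cos hν.ne' ψ
  rw [h, integral_cos, smul_eq_mul, abs_mul, abs_of_pos (inv_pos.2 hν), div_eq_inv_mul]
  gcongr
  refine (abs_sub _ _).trans ?_
  linarith [Real.abs_sin_le_one (ν * s + ψ), Real.abs_sin_le_one (ν * r + ψ)]

/-- Homogeneity of the weight reduces every frequency to frequency `1`. -/
theorem integral_cos_div_rpow_scale {ν β : ℝ} (hν : 0 < ν) (ψ : ℝ) {R : ℝ} (hR : 0 ≤ R) :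
    ∫ s in (0 : ℝ)..R, Real.cos (ν * s + ψ) / s ^ (1 - β) =
      ν ^ (-β) * ∫ s in (0 : ℝ)..(ν * R), Real.cos (1 * s + ψ) / s ^ (1 - β) := by
  have h := integral_comp_mul_left (a := 0) (b := R)
    (fun s => Real.cos (1 * s + ψ) / s ^ (1 - β)) hν.ne'
  rw [mul_zero, smul_eq_mul, eq_inv_mul_iff_mul_eq₀ hν.ne'] at h
  rw [← h, ← mul_assoc, ← intervalIntegral.integral_const_mul]
  refine integral_congr fun s hs => ?_
  rw [uIcc_of_le hR] at hs
  have h1 : ν ^ (-β) * ν = ν ^ (1 - β) := by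
    rw [← Real.rpow_add_one hν.ne']; ring_nf
  have h2 := (Real.rpow_pos_of_pos hν (1 - β)).ne'
  simp only [one_mul]
  rw [h1, Real.mul_rpow hν.le hs.1]
  field_simp

/-- Two integrations by parts at once. The second primitive `1 - cos s` vanishes to second order at
`0`, so the oscillating integrand is traded for one of constant sign. -/
theorem hasDerivAt_cos_primitive (β : ℝ) {s : ℝ} (hs : 0 < s) :
    HasDerivAt (fun s => s ^ (β - 1) * Real.sin s + (1 - β) * (s ^ (β - 2) * (1 - Real.cos s)))
      (s ^ (β - 1) * Real.cos s - (1 - β) * (2 - β) * (s ^ (β - 3) * (1 - Real.cos s))) s := by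
  have h1 : HasDerivAt (fun s : ℝ => s ^ (β - 1)) ((β - 1) * s ^ (β - 1 - 1)) s :=
    Real.hasDerivAt_rpow_const (Or.inl hs.ne')
  have h2 : HasDerivAt (fun s : ℝ => s ^ (β - 2)) ((β - 2) * s ^ (β - 2 - 1)) s :=
    Real.hasDerivAt_rpow_const (Or.inl hs.ne')
  rw [show β - 1 - 1 = β - 2 by ring] at h1
  rw [show β - 2 - 1 = β - 3 by ring] at h2
  refine ((h1.mul (Real.hasDerivAt_sin s)).add
    ((h2.mul ((Real.hasDerivAt_cos s).const_sub 1)).const_mul (1 - β))).congr_deriv ?_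
  ring

/-- The boundary terms of `hasDerivAt_cos_primitive` vanish at `0` and `∞`, leaving `(1 - β) * (2 -
β)` times the integral of the nonnegative `s ^ (β - 3) * (1 - cos s)`. Its part `m` over `[1, 2]` is
already a positive lower bound. -/
theorem integral_cos_div_rpow_pos_of_tendsto {β L : ℝ} (hβ : 0 < β) (hβ1 : β < 1)
    (hL : Tendsto (fun R => ∫ s in (0 : ℝ)..R, Real.cos s / s ^ (1 - β)) atTop (𝓝 L)) :
    0 < L := by
  set m := ∫ s in (1 : ℝ)..2, s ^ (β - 3) * (1 - Real.cos s) with hm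
  have hcont : ∀ a b : ℝ, 0 < a → a ≤ b →
      IntervalIntegrable (fun s => s ^ (β - 3) * (1 - Real.cos s)) volume a b := by
    intro a b ha hab
    apply ContinuousOn.intervalIntegrable
    intro s hs
    rw [uIcc_of_le hab] at hs
    exact ((Real.continuousAt_rpow_const s _ (Or.inl (ha.trans_le hs.1).ne')).mul
      (by fun_prop)).continuousWithinAt
  have hmpos : 0 < m := by
    refine intervalIntegral_pos_of_pos_on (hcont 1 2 one_pos one_le_two) ?_ one_lt_two
    intro s hs
    have hs0 : 0 < s := one_pos.trans hs.1
    refine mul_pos (Real.rpow_pos_of_pos hs0 _) ?_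
    have : Real.cos s < Real.cos 0 := Real.cos_lt_cos_of_nonneg_of_le_pi le_rfl
      (by linarith [hs.2, Real.pi_gt_three]) hs0
    rw [Real.cos_zero] at this
    linarith
  set κ := (1 - β) * (2 - β) with hκ
  have hκpos : 0 < κ := mul_pos (by linarith) (by linarith)
  have hlow : ∀ δ R : ℝ, 0 < δ → δ ≤ 1 → 2 ≤ R →
      κ * m - 2 * δ ^ β - 1 / R ^ (1 - β) ≤ ∫ s in (0 : ℝ)..R, Real.cos s / s ^ (1 - β) := by
    intro δ R hδ hδ1 hR
    have hδR : δ ≤ R := by linarith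
    have hR0 : 0 < R := by linarith
    have hi1 := intervalIntegrable_div_rpow hβ Real.continuous_cos le_rfl hδ.le
    have hi2 := intervalIntegrable_div_rpow hβ Real.continuous_cos hδ.le hR0.le
    have e1 : 0 ≤ ∫ s in (0 : ℝ)..δ, Real.cos s / s ^ (1 - β) := by
      refine integral_nonneg hδ.le fun s hs => div_nonneg ?_ (Real.rpow_nonneg hs.1 _)
      apply Real.cos_nonneg_of_mem_Icc
      constructor <;> linarith [hs.1, hs.2, Real.pi_gt_three]
    have hi2' : IntervalIntegrable (fun s => s ^ (β - 1) * Real.cos s) volume δ R := by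
      refine hi2.congr fun s hs => ?_
      rw [uIoc_of_le hδR] at hs
      rw [show β - 1 = -(1 - β) by ring, Real.rpow_neg (hδ.trans hs.1).le, div_eq_inv_mul]
    have e2 : ∫ s in δ..R, Real.cos s / s ^ (1 - β) = ∫ s in δ..R, s ^ (β - 1) * Real.cos s := by
      refine integral_congr fun s hs => ?_
      rw [uIcc_of_le hδR] at hs
      rw [show β - 1 = -(1 - β) by ring, Real.rpow_neg (hδ.trans_le hs.1).le, div_eq_inv_mul]
    have e3 := integral_eq_sub_of_hasDerivAt (a := δ) (b := R)
      (fun s hs => hasDerivAt_cos_primitive β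
        (show 0 < s by rw [uIcc_of_le hδR] at hs; exact hδ.trans_le hs.1))
      (hi2'.sub ((hcont δ R hδ hδR).const_mul _))
    rw [integral_sub hi2' ((hcont δ R hδ hδR).const_mul _),
      intervalIntegral.integral_const_mul] at e3
    have hnn : ∀ s : ℝ, 0 ≤ s → 0 ≤ s ^ (β - 3) * (1 - Real.cos s) := fun s hs =>
      mul_nonneg (Real.rpow_nonneg hs _) (by linarith [Real.cos_le_one s])
    have e4 : m ≤ ∫ s in δ..R, s ^ (β - 3) * (1 - Real.cos s) := by
      refine integral_mono_interval hδ1 one_le_two hR ?_ (hcont δ R hδ hδR)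
      refine (ae_restrict_mem measurableSet_Ioc).mono fun s hs => hnn s (hδ.trans hs.1).le
    have e5 : -(1 / R ^ (1 - β)) ≤ R ^ (β - 1) * Real.sin R +
        (1 - β) * (R ^ (β - 2) * (1 - Real.cos R)) := by
      have h1 : 0 ≤ (1 - β) * (R ^ (β - 2) * (1 - Real.cos R)) :=
        mul_nonneg (by linarith) (mul_nonneg (Real.rpow_nonneg hR0.le _)
          (by linarith [Real.cos_le_one R]))
      rw [one_div, ← Real.rpow_neg hR0.le, show -(1 - β) = β - 1 by ring]
      nlinarith [Real.rpow_nonneg hR0.le (β - 1), Real.neg_one_le_sin R]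
    have e6 : δ ^ (β - 1) * Real.sin δ + (1 - β) * (δ ^ (β - 2) * (1 - Real.cos δ)) ≤
        2 * δ ^ β := by
      have h1 : δ ^ (β - 1) * δ = δ ^ β := by rw [← Real.rpow_add_one hδ.ne']; ring_nf
      have h2 : δ ^ (β - 2) * δ ^ 2 = δ ^ β := by
        rw [← Real.rpow_natCast, ← Real.rpow_add hδ]; norm_num
      have h3 : δ ^ (β - 1) * Real.sin δ ≤ δ ^ β := by
        rw [← h1]; exact mul_le_mul_of_nonneg_left (Real.sin_le hδ.le) (Real.rpow_nonneg hδ.le _)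
      have h4 : δ ^ (β - 2) * (1 - Real.cos δ) ≤ δ ^ β := by
        rw [← h2]
        refine mul_le_mul_of_nonneg_left ?_ (Real.rpow_nonneg hδ.le _)
        nlinarith [Real.one_sub_sq_div_two_le_cos (x := δ)]
      have h5 := mul_nonneg (Real.rpow_nonneg hδ.le (β - 2))
        (show 0 ≤ 1 - Real.cos δ by linarith [Real.cos_le_one δ])
      nlinarith
    rw [← integral_add_adjacent_intervals hi1 hi2, e2]
    nlinarith [mul_le_mul_of_nonneg_left e4 hκpos.le]
  have hlow2 : ∀ R : ℝ, 2 ≤ R →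
      κ * m - 1 / R ^ (1 - β) ≤ ∫ s in (0 : ℝ)..R, Real.cos s / s ^ (1 - β) := by
    intro R hR
    have ht : Tendsto (fun δ : ℝ => κ * m - 2 * δ ^ β - 1 / R ^ (1 - β)) (𝓝[>] 0)
        (𝓝 (κ * m - 2 * 0 ^ β - 1 / R ^ (1 - β))) := by
      refine Tendsto.mono_left ?_ nhdsWithin_le_nhds
      exact ((((Real.continuousAt_rpow_const 0 β (Or.inr hβ.le)).tendsto).const_mul 2).const_sub
        _).sub_const _
    rw [Real.zero_rpow hβ.ne', mul_zero, sub_zero] at ht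
    refine le_of_tendsto ht ?_
    filter_upwards [Ioo_mem_nhdsGT (show (0 : ℝ) < 1 from one_pos)] with δ hδ
    exact hlow δ R hδ.1 hδ.2.le hR
  have ht2 : Tendsto (fun R : ℝ => κ * m - 1 / R ^ (1 - β)) atTop (𝓝 (κ * m - 0)) :=
    ((tendsto_rpow_atTop (by linarith : 0 < 1 - β)).const_div_atTop 1).const_sub _
  have := le_of_tendsto_of_tendsto ht2 hL ((eventually_ge_atTop 2).mono hlow2)
  rw [sub_zero] at this
  exact (mul_pos hκpos hmpos).trans_le this

/-! ### Fractional integrals -/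

theorem hasLeftFracIntegral_iff {β : ℝ} (hβ : 0 < β) {f : ℝ → ℝ} {x I : ℝ} :
    HasLeftFracIntegral β f x I ↔
      Tendsto (fun R => 1 / Real.Gamma β * ∫ s in (0 : ℝ)..R, f (x - s) / s ^ (1 - β))
        atTop (𝓝 I) := by
  have h : ∀ A : ℝ, ∫ s in A..x, f s / (x - s) ^ (1 - β) =
      ∫ s in (0 : ℝ)..(x - A), f (x - s) / s ^ (1 - β) := by
    intro A
    have := integral_comp_sub_left (a := A) (b := x) (fun s => f (x - s) / s ^ (1 - β)) x
    simpa using this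
  simp only [HasLeftFracIntegral, hβ.ne', false_and, hβ, true_and, false_or, h]
  constructor
  · intro ht
    have := ht.comp (tendsto_atBot_add_const_left atTop x tendsto_neg_atTop_atBot)
    simpa [Function.comp_def] using this
  · intro ht
    have := ht.comp (tendsto_atTop_add_const_left atBot x tendsto_neg_atBot_atTop)
    simpa only [Function.comp_def, ← sub_eq_add_neg] using this

/-- Reflection exchanges the two sides, so only left integrals have to be analysed. -/
theorem hasRightFracIntegral_iff_left {β : ℝ} (hβ : 0 ≤ β) {f : ℝ → ℝ} {x I : ℝ} :
    HasRightFracIntegral β f x I ↔ HasLeftFracIntegral β (fun y => f (-y)) (-x) I := by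
  rcases hβ.eq_or_lt with rfl | hβ
  · simp [HasRightFracIntegral, HasLeftFracIntegral]
  rw [hasLeftFracIntegral_iff hβ]
  have h : ∀ A : ℝ, ∫ s in x..A, f s / (s - x) ^ (1 - β) =
      ∫ s in (0 : ℝ)..(A - x), f (-(-x - s)) / s ^ (1 - β) := by
    intro A
    have := integral_comp_sub_right (a := x) (b := A) (fun s => f (-(-x - s)) / s ^ (1 - β)) x
    simpa using this
  simp only [HasRightFracIntegral, hβ.ne', false_and, hβ, true_and, false_or, h]
  constructor
  · intro ht
    have := ht.comp (tendsto_atTop_add_const_right atTop x tendsto_id)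
    simpa [Function.comp_def] using this
  · intro ht
    exact ht.comp (tendsto_atTop_add_const_right atTop (-x) tendsto_id)

theorem HasLeftFracIntegral.unique {β : ℝ} {f : ℝ → ℝ} {x I J : ℝ}
    (h : HasLeftFracIntegral β f x I) (h' : HasLeftFracIntegral β f x J) : I = J := by
  rcases h with ⟨h0, h1⟩ | ⟨h0, h1⟩ <;> rcases h' with ⟨h0', h1'⟩ | ⟨h0', h1'⟩
  · rw [h1, h1']
  · linarith
  · linarith
  · exact tendsto_nhds_unique h1 h1'

theorem HasLeftFracIntegral.comp_add {β : ℝ} (hβ : 0 ≤ β) {f : ℝ → ℝ} {x I p : ℝ}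
    (h : HasLeftFracIntegral β f (x + p) I) :
    HasLeftFracIntegral β (fun y => f (y + p)) x I := by
  rcases hβ.eq_or_lt with rfl | hβ
  · simpa [HasLeftFracIntegral] using h
  rw [hasLeftFracIntegral_iff hβ] at h ⊢
  simpa only [sub_add_eq_add_sub] using h

/-- Left fractional integration of order `β` multiplies the waves of frequency `ν` by
`ρ * ν ^ (-β)` and shifts their phase by `θ`. -/
def IsFracMultiplier (β ρ θ : ℝ) : Prop :=
  ∀ ν : ℝ, 0 < ν → ∀ φ x : ℝ, HasLeftFracIntegral β (fun y => Real.cos (ν * y + φ)) x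
    (ρ * ν ^ (-β) * Real.cos (ν * x + φ - θ))

/-- By scaling and the addition formula everything reduces to the cosine moment `C` and the sine
moment `S` of the weight at frequency `1`; up to the factor `1 / Γ(β)`, `ρ` and `θ` are the polar
coordinates of `C + i S`. Thus `ρ * cos θ` has the sign of `C`. -/
theorem exists_isFracMultiplier {β : ℝ} (hβ : 0 ≤ β) (hβ1 : β < 1) :
    ∃ ρ θ : ℝ, 0 < ρ * Real.cos θ ∧ IsFracMultiplier β ρ θ := by
  rcases hβ.eq_or_lt with rfl | hβ
  · refine ⟨1, 0, by simp, fun ν hν φ x => ?_⟩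
    simp [HasLeftFracIntegral]
  have hlim : ∀ ψ : ℝ, ∃ L, Tendsto
      (fun R => ∫ s in (0 : ℝ)..R, Real.cos (1 * s + ψ) / s ^ (1 - β)) atTop (𝓝 L) := fun ψ =>
    exists_tendsto_integral_div_rpow hβ hβ1 (by fun_prop) (abs_integral_cos_le one_pos ψ)
  obtain ⟨C, hC⟩ := hlim 0
  -- The phase `-π / 2` turns the cosine into a sine.
  obtain ⟨S, hS⟩ := hlim (-(Real.pi / 2))
  have hCpos : 0 < C := integral_cos_div_rpow_pos_of_tendsto hβ hβ1 (by simpa using hC)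
  have hΓ := Real.Gamma_pos_of_pos hβ
  refine ⟨1 / Real.Gamma β * ‖(⟨C, S⟩ : ℂ)‖, Complex.arg ⟨C, S⟩, ?_, fun ν hν φ x => ?_⟩
  · rw [mul_assoc, Complex.norm_mul_cos_arg]
    positivity
  rw [hasLeftFracIntegral_iff hβ]
  have hval : 1 / Real.Gamma β * ‖(⟨C, S⟩ : ℂ)‖ * ν ^ (-β) *
      Real.cos (ν * x + φ - Complex.arg ⟨C, S⟩) =
      1 / Real.Gamma β * (ν ^ (-β) * (Real.cos (ν * x + φ) * C + Real.sin (ν * x + φ) * S)) := by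
    have h1 : ‖(⟨C, S⟩ : ℂ)‖ * Real.cos (Complex.arg ⟨C, S⟩) = C := Complex.norm_mul_cos_arg _
    have h2 : ‖(⟨C, S⟩ : ℂ)‖ * Real.sin (Complex.arg ⟨C, S⟩) = S := Complex.norm_mul_sin_arg _
    rw [Real.cos_sub]
    linear_combination (1 / Real.Gamma β * ν ^ (-β)) *
      (Real.cos (ν * x + φ) * h1 + Real.sin (ν * x + φ) * h2)
  rw [hval]
  refine Tendsto.const_mul _ ?_
  have hmain := ((hC.const_mul (Real.cos (ν * x + φ))).add
    (hS.const_mul (Real.sin (ν * x + φ)))).const_mul (ν ^ (-β))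
  refine (hmain.comp (tendsto_id.const_mul_atTop hν)).congr' ?_
  filter_upwards [eventually_ge_atTop 0] with R hR
  simp only [Function.comp_def, id]
  have hνR : 0 ≤ ν * R := by positivity
  have hi : ∀ ψ, IntervalIntegrable (fun s => Real.cos (1 * s + ψ) / s ^ (1 - β)) volume 0
    (ν * R) := fun ψ => intervalIntegrable_div_rpow hβ (by fun_prop) le_rfl hνR
  rw [← intervalIntegral.integral_const_mul, ← intervalIntegral.integral_const_mul,
    ← integral_add ((hi _).const_mul _) ((hi _).const_mul _)]
  have := integral_cos_div_rpow_scale (β := β) hν (-(ν * x + φ)) hR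
  calc _ = ν ^ (-β) * ∫ s in (0 : ℝ)..(ν * R),
        Real.cos (1 * s + (-(ν * x + φ))) / s ^ (1 - β) := by
        congr 1
        refine integral_congr fun s _ => ?_
        rw [Real.cos_add (1 * s) (-(ν * x + φ)), Real.cos_neg, Real.sin_neg,
          ← sub_eq_add_neg (1 * s), Real.cos_sub_pi_div_two, add_zero]
        ring
    _ = _ := by
        rw [← this]
        refine integral_congr fun s _ => ?_
        rw [← Real.cos_neg]
        ring_nf

/-! ### Functions with bounded primitive and the potential of a Riesz derivative -/

theorem Function.Periodic.exists_abs_le {f : ℝ → ℝ} {p : ℝ} (hf : Function.Periodic f p)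
    (hp : 0 < p) (hc : Continuous f) : ∃ M, ∀ x, |f x| ≤ M := by
  obtain ⟨M, hM⟩ := (hf.isBounded_of_continuous hp.ne' hc).exists_norm_le
  exact ⟨M, fun x => hM _ (mem_range_self x)⟩

/-- Zero mean makes the primitive periodic, hence bounded. This is the only property of `MemCI` that
the uniqueness argument uses. -/
theorem MemCI.exists_integral_bound {f : ℝ → ℝ} (h : MemCI f) (hc : Continuous f) :
    ∃ B : ℝ, ∀ r s, |∫ y in r..s, f y| ≤ B := by
  obtain ⟨a, b, hab, hper, g, hg, hfg, -, hint⟩ := h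
  have hi : ∀ r s, IntervalIntegrable f volume r s := fun r s => hc.intervalIntegrable _ _
  have h0 : ∫ y in a..b, f y = 0 := by
    rw [← hint, integral_of_le hab.le, integral_of_le hab.le, ← integral_Ioc_eq_integral_Ioo.symm,
      ← integral_Ioc_eq_integral_Ioo.symm]
    exact setIntegral_congr_fun measurableSet_Ioo hfg
  have hF : Function.Periodic (fun x => ∫ y in (0 : ℝ)..x, f y) (b - a) := by
    intro x
    simp only
    rw [← integral_add_adjacent_intervals (hi 0 x) (hi x _), hper.intervalIntegral_add_eq x a]
    simp [h0]
  obtain ⟨M, hM⟩ := hF.exists_abs_le (sub_pos.2 hab) (continuous_primitive hi 0)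
  refine ⟨M + M, fun r s => ?_⟩
  rw [← integral_interval_sub_left (hi 0 s) (hi 0 r)]
  exact (abs_sub _ _).trans (add_le_add (hM s) (hM r))

/-- The two decompositions need not share a period, so means over a period cannot be compared.
Instead, a nonzero difference `c - d` would give a linearly growing primitive. -/
theorem const_unique_of_integral_bound {f g : ℝ → ℝ} {c d B B' : ℝ} (hf : Continuous f)
    (hg : Continuous g) (hB : ∀ r s, |∫ y in r..s, f y| ≤ B)
    (hB' : ∀ r s, |∫ y in r..s, g y| ≤ B') (h : ∀ y, f y + c = g y + d) : c = d := by
  by_contra hne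
  have hpos : 0 < |c - d| := abs_pos.2 (sub_ne_zero.2 hne)
  have key : ∀ x : ℝ, 0 ≤ x → x * |c - d| ≤ B + B' := by
    intro x hx
    have h1 : ∫ y in (0 : ℝ)..x, (g y - f y) = x * (c - d) := by
      rw [show (fun y => g y - f y) = fun _ => c - d from funext fun y => by linarith [h y]]
      simp [mul_sub]
    rw [integral_sub (hg.intervalIntegrable _ _) (hf.intervalIntegrable _ _)] at h1
    rw [show x * |c - d| = |x * (c - d)| by rw [abs_mul, abs_of_nonneg hx], ← h1]
    refine (abs_sub _ _).trans ?_
    linarith [hB 0 x, hB' 0 x]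
  have hBB : 0 ≤ B + B' := add_nonneg ((abs_nonneg _).trans (hB 0 0)) ((abs_nonneg _).trans (hB' 0 0))
  have := key ((B + B' + 1) / |c - d|) (by positivity)
  rw [div_mul_cancel₀ _ hpos.ne'] at this
  linarith

theorem HasSecondDerivAt.hasDerivAt_deriv {g : ℝ → ℝ} {d x : ℝ} (h : HasSecondDerivAt g d x) :
    HasDerivAt g (deriv g x) x ∧ HasDerivAt (deriv g) d x := by
  obtain ⟨g', h1, h2⟩ := h
  refine ⟨h1.self_of_nhds.differentiableAt.hasDerivAt, h2.congr_of_eventuallyEq ?_⟩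
  exact h1.mono fun y hy => hy.deriv

/-- `Il` and `Ir` are the fractional integrals of order `β` of `f₀`, and the second derivative of
`Il + Ir` is `κ * d`. -/
structure IsFracPotential (β κ : ℝ) (f₀ d Il Ir H' : ℝ → ℝ) : Prop where
  continuous : Continuous f₀
  bound : ∃ B, ∀ r s, |∫ y in r..s, f₀ y| ≤ B
  left : ∀ y, HasLeftFracIntegral β f₀ y (Il y)
  right : ∀ y, HasRightFracIntegral β f₀ y (Ir y)
  continuous_left : Continuous Il
  continuous_right : Continuous Ir
  hasDerivAt : ∀ x, HasDerivAt (fun y => Il y + Ir y) (H' x) x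
  hasDerivAt' : ∀ x, HasDerivAt H' (κ * d x) x

/-- `HasRieszDerivAt` may choose a different decomposition `f = f₀ + c` at every point. Uniqueness
of the constant and of the fractional integrals identifies all of them with the one chosen at `0`,
which yields global potentials. -/
theorem exists_isFracPotential {α σ : ℝ} (hσ : 0 < σ) (hα : α ≤ 2)
    (hcos : Real.cos (α * (Real.pi / 2)) < 0)
    {f d : ℝ → ℝ} (hf : Continuous f) (h : ∀ x, HasRieszDerivAt α σ f (d x) x) :
    ∃ (c : ℝ) (f₀ Il Ir H' : ℝ → ℝ), (∀ y, f y = f₀ y + c) ∧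
      IsFracPotential (2 - α) (-(2 * Real.cos (α * (Real.pi / 2)) / σ)) f₀ d Il Ir H' := by
  have hβ : 0 ≤ 2 - α := by linarith
  obtain ⟨f₀, c, hCI, hfc, l, r, ⟨Il, hIl, -⟩, ⟨Ir, hIr, -⟩, -⟩ := h 0
  have hcf : ∀ (g : ℝ → ℝ) (e : ℝ), (∀ y, f y = g y + e) → Continuous g := fun g e hg => by
    rw [show g = fun y => f y - e from funext fun y => by rw [hg y]; ring]
    fun_prop
  have hf₀ := hcf f₀ c hfc
  obtain ⟨B, hB⟩ := hCI.exists_integral_bound hf₀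
  have key : ∀ x, ∃ l r : ℝ, HasSecondDerivAt Il l x ∧ HasSecondDerivAt Ir r x ∧
      d x = -(σ / (2 * Real.cos (α * (Real.pi / 2)))) * (l + r) := by
    intro x
    obtain ⟨f₁, c₁, hCI₁, hfc₁, l, r, ⟨Jl, hJl, hl⟩, ⟨Jr, hJr, hr⟩, hd⟩ := h x
    have hf₁ := hcf f₁ c₁ hfc₁
    obtain ⟨B₁, hB₁⟩ := hCI₁.exists_integral_bound hf₁
    have hcc : c = c₁ := const_unique_of_integral_bound hf₀ hf₁ hB hB₁
      fun y => by rw [← hfc, ← hfc₁]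
    have hff : f₁ = f₀ := funext fun y => by linarith [hfc y, hfc₁ y]
    subst hff
    have e1 : Jl = Il := funext fun y => (hJl y).unique (hIl y)
    have e2 : Jr = Ir := funext fun y => by
      have h1 := hJr y
      have h2 := hIr y
      rw [hasRightFracIntegral_iff_left hβ] at h1 h2
      exact h1.unique h2
    subst e1 e2
    exact ⟨l, r, hl, hr, hd⟩
  refine ⟨c, f₀, Il, Ir, fun y => deriv Il y + deriv Ir y, hfc, hf₀, ⟨B, hB⟩,
    hIl, hIr, ?_, ?_, fun x => ?_, fun x => ?_⟩
  · refine continuous_iff_continuousAt.2 fun x => ?_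
    obtain ⟨l, r, hl, hr, -⟩ := key x
    exact hl.hasDerivAt_deriv.1.continuousAt
  · refine continuous_iff_continuousAt.2 fun x => ?_
    obtain ⟨l, r, hl, hr, -⟩ := key x
    exact hr.hasDerivAt_deriv.1.continuousAt
  · obtain ⟨l, r, hl, hr, -⟩ := key x
    exact hl.hasDerivAt_deriv.1.add hr.hasDerivAt_deriv.1
  · obtain ⟨l, r, hl, hr, hd⟩ := key x
    refine (hl.hasDerivAt_deriv.2.add hr.hasDerivAt_deriv.2).congr_deriv ?_
    rw [hd]
    have := hcos.ne
    generalize Real.cos (α * (Real.pi / 2)) = C at *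
    field_simp

namespace IsFracPotential

variable {β κ : ℝ} {f₀ d Il Ir H' : ℝ → ℝ}

theorem periodic_left (h : IsFracPotential β κ f₀ d Il Ir H') (hβ : 0 ≤ β) {p : ℝ}
    (hp : Function.Periodic f₀ p) : Function.Periodic Il p := by
  intro x
  have h1 := (h.left (x + p)).comp_add hβ
  rw [show (fun y => f₀ (y + p)) = f₀ from funext hp] at h1
  exact h1.unique (h.left x)

theorem periodic_right (h : IsFracPotential β κ f₀ d Il Ir H') (hβ : 0 ≤ β) {p : ℝ}
    (hp : Function.Periodic f₀ p) : Function.Periodic Ir p := by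
  intro x
  have h1 := h.right x
  have h2 := h.right (x + p)
  rw [hasRightFracIntegral_iff_left hβ] at h1 h2
  rw [show -x = -(x + p) + p by ring] at h1
  have h3 := h1.comp_add hβ
  rw [show (fun y => f₀ (-(y + p))) = fun y => f₀ (-y) from funext fun y => by
    rw [← hp (-(y + p))]; ring_nf] at h3
  exact h2.unique h3

theorem left_neg (h : IsFracPotential β κ f₀ d Il Ir H') (hβ : 0 ≤ β)
    (he : ∀ x, f₀ (-x) = f₀ x) (x : ℝ) : Il (-x) = Ir x := by
  have h1 := h.right x
  rw [hasRightFracIntegral_iff_left hβ, show (fun y => f₀ (-y)) = f₀ from funext he] at h1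
  exact (h.left (-x)).unique h1

theorem periodic_deriv (h : IsFracPotential β κ f₀ d Il Ir H') (hβ : 0 ≤ β) {p : ℝ}
    (hp : Function.Periodic f₀ p) : Function.Periodic H' p := by
  intro x
  have h1 := (h.hasDerivAt (x + p)).comp_add_const x p
  rw [show (fun y => Il (y + p) + Ir (y + p)) = fun y => Il y + Ir y from funext fun y => by
    rw [h.periodic_left hβ hp, h.periodic_right hβ hp]] at h1
  exact h1.unique (h.hasDerivAt x)

theorem periodic_second (h : IsFracPotential β κ f₀ d Il Ir H') (hβ : 0 ≤ β) (hκ : κ ≠ 0) {p : ℝ}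
    (hp : Function.Periodic f₀ p) : Function.Periodic d p := by
  intro x
  have h1 := (h.hasDerivAt' (x + p)).comp_add_const x p
  rw [show (fun y => H' (y + p)) = H' from funext (h.periodic_deriv hβ hp)] at h1
  exact mul_left_cancel₀ hκ (h1.unique (h.hasDerivAt' x))

/-- For even `f₀` reflection swaps `Il` and `Ir`, so their sum is even, `H'` is odd and `d` is even.
This is what carries the equation of a Neumann solution from `(0, 1)` to the other non-integer
points. -/
theorem even_second (h : IsFracPotential β κ f₀ d Il Ir H') (hβ : 0 ≤ β) (hκ : κ ≠ 0)
    (he : ∀ x, f₀ (-x) = f₀ x) (x : ℝ) : d (-x) = d x := by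
  have hodd : ∀ y, H' (-y) = -H' y := by
    intro y
    have h1 := (h.hasDerivAt (-y)).comp y (hasDerivAt_neg y)
    have h2 : ((fun y => Il y + Ir y) ∘ fun y => -y) = fun y => Il y + Ir y := funext fun z => by
      have e1 := h.left_neg hβ he z
      have e2 := h.left_neg hβ he (-z)
      rw [neg_neg] at e2
      simp only [Function.comp_def]
      rw [e1, ← e2]; ring
    have h3 : HasDerivAt ((fun y => Il y + Ir y) ∘ fun y => -y) (H' (-y) * -1) y := h1
    rw [h2] at h3
    linarith [h3.unique (h.hasDerivAt y)]
  have h1 : HasDerivAt (H' ∘ fun y => -y) (κ * d (-x) * -1) x :=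
    (h.hasDerivAt' (-x)).comp x (hasDerivAt_neg x)
  rw [show (H' ∘ fun y => -y) = -H' from funext hodd] at h1
  have := h1.unique (h.hasDerivAt' x).neg
  exact mul_left_cancel₀ hκ (by linarith)

end IsFracPotential

/-! ### Fractional integration on the Fourier side -/

/-- Translating `f` by `s` rotates the pair of its cosine and sine coefficients through the angle `ν
* s`. -/
theorem Function.Periodic.integral_comp_sub_mul_cos {f : ℝ → ℝ} {p ν : ℝ}
    (hp : Function.Periodic f p) (hf : Continuous f) {k : ℤ} (hk : ν * p = k * (2 * Real.pi))
    (φ s : ℝ) :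
    ∫ x in (0 : ℝ)..p, f (x - s) * Real.cos (ν * x + φ) =
      (∫ x in (0 : ℝ)..p, f x * Real.cos (ν * x + φ)) * Real.cos (ν * s) -
      (∫ x in (0 : ℝ)..p, f x * Real.sin (ν * x + φ)) * Real.sin (ν * s) := by
  have hper : Function.Periodic (fun x => f x * Real.cos (ν * (x + s) + φ)) p := by
    intro x
    simp only
    rw [hp x, show ν * (x + p + s) + φ = ν * (x + s) + φ + ν * p by ring, hk,
      Real.cos_add_int_mul_two_pi]
  have h1 := integral_comp_sub_right (a := 0) (b := p)
    (fun x => f x * Real.cos (ν * (x + s) + φ)) s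
  simp only [sub_add_cancel] at h1
  rw [h1, show p - s = 0 - s + p by ring, hper.intervalIntegral_add_eq (0 - s) 0, zero_add,
    ← intervalIntegral.integral_mul_const, ← intervalIntegral.integral_mul_const,
    ← integral_sub (Continuous.intervalIntegrable (by fun_prop) _ _)
      (Continuous.intervalIntegrable (by fun_prop) _ _)]
  refine integral_congr fun x _ => ?_
  rw [show ν * (x + s) + φ = ν * x + φ + ν * s by ring, Real.cos_add]
  ring

theorem integral_integral_div_rpow_swap {β R p : ℝ} (hβ : 0 < β) (hR : 0 ≤ R) (hp : 0 ≤ p)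
    {f g : ℝ → ℝ} (hf : Continuous f) (hg : Continuous g) {M N : ℝ} (hM : ∀ x, |f x| ≤ M)
    (hN : ∀ x, |g x| ≤ N) :
    ∫ x in (0 : ℝ)..p, (∫ s in (0 : ℝ)..R, f (x - s) / s ^ (1 - β)) * g x =
      ∫ s in (0 : ℝ)..R, (∫ x in (0 : ℝ)..p, f (x - s) * g x) / s ^ (1 - β) := by
  simp only [← intervalIntegral.integral_mul_const, ← intervalIntegral.integral_div]
  simp only [integral_of_le hR, integral_of_le hp]
  rw [integral_integral_swap]
  · refine integral_congr_ae (Eventually.of_forall fun s => ?_)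
    refine integral_congr_ae (Eventually.of_forall fun x => ?_)
    simp only
    ring
  · have h1 : Integrable (fun s : ℝ => M * N * (s ^ (1 - β))⁻¹) (volume.restrict (Ioc 0 R)) :=
      (((intervalIntegrable_iff_integrableOn_Ioc_of_le hR).1
        (intervalIntegrable_inv_rpow hβ le_rfl hR)).integrable).const_mul _
    have h2 := h1.comp_snd (volume.restrict (Ioc 0 p))
    refine h2.mono ?_ ?_
    · apply Measurable.aestronglyMeasurable
      have := hf.measurable
      have := hg.measurable
      unfold Function.uncurry
      fun_prop
    · refine Eventually.of_forall fun z => ?_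
      simp only [Function.uncurry, Real.norm_eq_abs, abs_mul, abs_div, abs_inv]
      have hM0 : 0 ≤ M := (abs_nonneg _).trans (hM 0)
      have hN0 : 0 ≤ N := (abs_nonneg _).trans (hN 0)
      rw [abs_of_nonneg hM0, abs_of_nonneg hN0, div_eq_mul_inv, mul_right_comm]
      gcongr
      · exact hM _
      · exact hN _

theorem IsFracMultiplier.tendsto {β ρ θ ν : ℝ} (h : IsFracMultiplier β ρ θ) (hβ : 0 < β)
    (hν : 0 < ν) (ψ : ℝ) :
    Tendsto (fun R => 1 / Real.Gamma β * ∫ s in (0 : ℝ)..R, Real.cos (ν * s + ψ) / s ^ (1 - β))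
      atTop (𝓝 (ρ * ν ^ (-β) * Real.cos (ψ + θ))) := by
  have h1 := (hasLeftFracIntegral_iff hβ).1 (h ν hν (-ψ) 0)
  rw [show ν * 0 + -ψ - θ = -(ψ + θ) by ring, Real.cos_neg] at h1
  refine h1.congr fun R => ?_
  congr 1
  refine integral_congr fun s _ => ?_
  rw [← Real.cos_neg]
  ring_nf

/-- The multiplier acts on the coefficients of an arbitrary continuous periodic `f` with bounded
primitive. The truncated integrals, tested against the wave, have two limits that must agree: one by
dominated convergence, the other by Fubini at finite `R`, where translation rotates the coefficients
and leaves only moments of waves. -/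
theorem IsFracMultiplier.integral_mul_cos {β ρ θ ν : ℝ} (h : IsFracMultiplier β ρ θ)
    (hβ : 0 ≤ β) (hβ1 : β < 1) (hν : 0 < ν) {f I : ℝ → ℝ} {p : ℝ} (hp0 : 0 < p)
    (hf : Continuous f) (hp : Function.Periodic f p) {B : ℝ} (hB : ∀ r s, |∫ y in r..s, f y| ≤ B)
    {k : ℤ} (hk : ν * p = k * (2 * Real.pi))
    (hI : ∀ y, HasLeftFracIntegral β f y (I y)) (φ : ℝ) :
    ∫ x in (0 : ℝ)..p, I x * Real.cos (ν * x + φ) =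
      ρ * ν ^ (-β) * ∫ x in (0 : ℝ)..p, f x * Real.cos (ν * x + φ + θ) := by
  have hsplit : ∫ x in (0 : ℝ)..p, f x * Real.cos (ν * x + φ + θ) =
      (∫ x in (0 : ℝ)..p, f x * Real.cos (ν * x + φ)) * Real.cos θ -
      (∫ x in (0 : ℝ)..p, f x * Real.sin (ν * x + φ)) * Real.sin θ := by
    rw [← intervalIntegral.integral_mul_const, ← intervalIntegral.integral_mul_const,
      ← integral_sub (Continuous.intervalIntegrable (by fun_prop) _ _)
        (Continuous.intervalIntegrable (by fun_prop) _ _)]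
    refine integral_congr fun x _ => ?_
    rw [Real.cos_add]
    ring
  rcases hβ.eq_or_lt with rfl | hβ
  · have hIf : I = f := funext fun y => by simpa [HasLeftFracIntegral] using hI y
    -- Even for `β = 0` the pair `ρ`, `θ` is arbitrary; the multiplier property at frequency `1`
    -- supplies the identity that is needed.
    have hw : ∀ y, Real.cos y = ρ * Real.cos (y - θ) := fun y => by
      have := h 1 one_pos 0 y
      simpa [HasLeftFracIntegral, eq_comm] using this
    rw [hIf, neg_zero, Real.rpow_zero, mul_one, ← intervalIntegral.integral_const_mul]
    refine integral_congr fun x _ => ?_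
    rw [← Real.cos_neg, hw, ← Real.cos_neg, show -(-(ν * x + φ) - θ) = ν * x + φ + θ by ring]
    ring
  obtain ⟨M, hM⟩ := hp.exists_abs_le hp0 hf
  have hM0 : 0 ≤ M := (abs_nonneg _).trans (hM 0)
  have hΓ := Real.Gamma_pos_of_pos hβ
  set C := ∫ x in (0 : ℝ)..p, f x * Real.cos (ν * x + φ) with hC
  set S := ∫ x in (0 : ℝ)..p, f x * Real.sin (ν * x + φ) with hS
  have hBx : ∀ x r s, |∫ y in r..s, f (x - y)| ≤ B := fun x r s => by
    rw [integral_comp_sub_left]; exact hB _ _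
  have hA1 : Tendsto (fun R => ∫ x in (0 : ℝ)..p,
      (1 / Real.Gamma β * ∫ s in (0 : ℝ)..R, f (x - s) / s ^ (1 - β)) * Real.cos (ν * x + φ)) atTop
      (𝓝 (∫ x in (0 : ℝ)..p, I x * Real.cos (ν * x + φ))) := by
    -- The dominating constant is the bound of `abs_integral_zero_div_rpow_le`, uniform in both `R`
    -- and `x`.
    refine tendsto_integral_filter_of_dominated_convergence
      (fun _ => 1 / Real.Gamma β * (M / β + B)) ?_ ?_ intervalIntegrable_const ?_
    · filter_upwards [eventually_ge_atTop 0] with R hR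
      refine (Continuous.mul (continuous_const.mul ?_) (by fun_prop)).aestronglyMeasurable
      refine continuous_of_dominated_interval (bound := fun s => M * (s ^ (1 - β))⁻¹) ?_ ?_
        ((intervalIntegrable_inv_rpow hβ le_rfl hR).const_mul M) ?_
      · intro x
        have := hf.measurable
        exact Measurable.aestronglyMeasurable (by fun_prop)
      · intro x
        refine Eventually.of_forall fun s hs => ?_
        rw [uIoc_of_le hR] at hs
        rw [Real.norm_eq_abs, abs_div, div_eq_mul_inv,
          abs_of_nonneg (Real.rpow_nonneg hs.1.le _)]
        exact mul_le_mul_of_nonneg_right (hM _) (inv_nonneg.2 (Real.rpow_nonneg hs.1.le _))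
      · exact Eventually.of_forall fun s _ => by fun_prop
    · filter_upwards [eventually_ge_atTop 0] with R hR
      refine Eventually.of_forall fun x _ => ?_
      rw [Real.norm_eq_abs, abs_mul, abs_mul, abs_of_pos (by positivity)]
      refine (mul_le_of_le_one_right (by positivity) (Real.abs_cos_le_one _)).trans ?_
      refine mul_le_mul_of_nonneg_left ?_ (by positivity)
      exact abs_integral_zero_div_rpow_le hβ hβ1 (by fun_prop) (fun s => hM _) hR (hBx x)
    · refine Eventually.of_forall fun x _ => ?_
      exact ((hasLeftFracIntegral_iff hβ).1 (hI x)).mul_const _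
  have hA2 : Tendsto (fun R => ∫ x in (0 : ℝ)..p,
      (1 / Real.Gamma β * ∫ s in (0 : ℝ)..R, f (x - s) / s ^ (1 - β)) * Real.cos (ν * x + φ)) atTop
      (𝓝 (C * (ρ * ν ^ (-β) * Real.cos (0 + θ)) +
        S * (ρ * ν ^ (-β) * Real.cos (Real.pi / 2 + θ)))) := by
    refine (((h.tendsto hβ hν 0).const_mul C).add
      ((h.tendsto hβ hν (Real.pi / 2)).const_mul S)).congr' ?_
    filter_upwards [eventually_ge_atTop 0] with R hR
    simp only [mul_assoc (1 / Real.Gamma β), intervalIntegral.integral_const_mul]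
    rw [integral_integral_div_rpow_swap hβ hR hp0.le hf (by fun_prop) hM
      (fun x => Real.abs_cos_le_one _)]
    simp only [hp.integral_comp_sub_mul_cos hf hk]
    have hi : ∀ ψ, IntervalIntegrable (fun s => Real.cos (ν * s + ψ) / s ^ (1 - β)) volume 0 R :=
      fun ψ => intervalIntegrable_div_rpow hβ (by fun_prop) le_rfl hR
    rw [mul_left_comm, mul_left_comm S, ← mul_add, ← intervalIntegral.integral_const_mul,
      ← intervalIntegral.integral_const_mul, ← integral_add ((hi _).const_mul _)
        ((hi _).const_mul _)]
    congr 1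
    refine integral_congr fun s _ => ?_
    rw [Real.cos_add_pi_div_two, add_zero]
    ring
  rw [tendsto_nhds_unique hA1 hA2, hsplit, zero_add, add_comm (Real.pi / 2), Real.cos_add_pi_div_two]
  ring

theorem Function.Periodic.integral_comp_neg {f : ℝ → ℝ} {p : ℝ} (hf : Function.Periodic f p) :
    ∫ x in (0 : ℝ)..p, f (-x) = ∫ x in (0 : ℝ)..p, f x := by
  rw [intervalIntegral.integral_comp_neg, neg_zero]
  have := hf.intervalIntegral_add_eq (-p) 0
  simpa using this

/-! ### Integration by parts and the symbol of the Riesz derivative -/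

theorem cos_periodic_of_mul_eq {ν p : ℝ} {k : ℤ} (hk : ν * p = k * (2 * Real.pi)) (φ : ℝ) :
    Function.Periodic (fun x => Real.cos (ν * x + φ)) p := by
  intro x
  simp only
  rw [show ν * (x + p) + φ = ν * x + φ + ν * p by ring, hk, Real.cos_add_int_mul_two_pi]

/-- Boundary terms cancel by periodicity; each derivative becomes a factor `ν` and a phase shift by
`-π / 2`. -/
theorem integral_deriv_mul_cos {G g : ℝ → ℝ} {ν p : ℝ} {k : ℤ} (hk : ν * p = k * (2 * Real.pi))
    (hG : ∀ x, HasDerivAt G (g x) x) (hg : Continuous g) (hper : Function.Periodic G p) (φ : ℝ) :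
    ∫ x in (0 : ℝ)..p, g x * Real.cos (ν * x + φ) =
      ν * ∫ x in (0 : ℝ)..p, G x * Real.cos (ν * x + (φ - Real.pi / 2)) := by
  have hc : ∀ x, HasDerivAt (fun x => Real.cos (ν * x + φ)) (-Real.sin (ν * x + φ) * ν) x :=
    fun x => by
      have h1 : HasDerivAt (fun x : ℝ => ν * x + φ) ν x := by
        simpa using ((hasDerivAt_id x).const_mul ν).add_const φ
      exact h1.cos
  have h := integral_mul_deriv_eq_deriv_mul (a := 0) (b := p) (fun x _ => hc x) (fun x _ => hG x)
    (Continuous.intervalIntegrable (by fun_prop) _ _) (hg.intervalIntegrable _ _)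
  have e1 : Real.cos (ν * p + φ) * G p = Real.cos (ν * 0 + φ) * G 0 := by
    have h1 := cos_periodic_of_mul_eq hk φ 0
    have h2 := hper 0
    simp only [zero_add] at h1 h2
    rw [h1, h2]
  rw [e1, sub_self, zero_sub] at h
  simp only [mul_comm (g _)]
  rw [h, ← intervalIntegral.integral_neg, ← intervalIntegral.integral_const_mul]
  refine integral_congr fun x _ => ?_
  rw [← add_sub_assoc, Real.cos_sub_pi_div_two]
  ring

/-- Two integrations by parts give `ν ^ 2` and the phase `-π`, that is, a minus sign. The left and
right integrals shift the test phase by `θ` and `-θ`, and the sum of the two waves is `2 * cos θ`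
times the unshifted one. -/
theorem IsFracPotential.integral_mul_cos {β κ ρ θ : ℝ} {f₀ d Il Ir H' : ℝ → ℝ}
    (h : IsFracPotential β κ f₀ d Il Ir H') (hm : IsFracMultiplier β ρ θ) (hβ : 0 ≤ β)
    (hβ1 : β < 1) (hd : Continuous d) {ν p : ℝ} (hp : 0 < p) (hper : Function.Periodic f₀ p)
    {k : ℤ} (hk : ν * p = k * (2 * Real.pi)) (hν : 0 < ν) (φ : ℝ) :
    κ * ∫ x in (0 : ℝ)..p, d x * Real.cos (ν * x + φ) =
      -(ν ^ 2 * (2 * (ρ * Real.cos θ) * ν ^ (-β))) *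
        ∫ x in (0 : ℝ)..p, f₀ x * Real.cos (ν * x + φ) := by
  obtain ⟨B, hB⟩ := h.bound
  have hf := h.continuous
  have hIl := h.continuous_left
  have hIr := h.continuous_right
  have hH' : Continuous H' := continuous_iff_continuousAt.2 fun x => (h.hasDerivAt' x).continuousAt
  have e1 : κ * ∫ x in (0 : ℝ)..p, d x * Real.cos (ν * x + φ) =
      ν * (ν * ∫ x in (0 : ℝ)..p, (Il x + Ir x) * Real.cos (ν * x + (φ - Real.pi))) := by
    rw [← intervalIntegral.integral_const_mul]
    simp only [← mul_assoc κ]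
    rw [integral_deriv_mul_cos hk h.hasDerivAt' (by fun_prop) (h.periodic_deriv hβ hper),
      integral_deriv_mul_cos hk h.hasDerivAt hH'
        ((h.periodic_left hβ hper).add (h.periodic_right hβ hper))]
    ring_nf
  have e2 : ∫ x in (0 : ℝ)..p, (Il x + Ir x) * Real.cos (ν * x + (φ - Real.pi)) =
      -((∫ x in (0 : ℝ)..p, Il x * Real.cos (ν * x + φ)) +
        ∫ x in (0 : ℝ)..p, Ir x * Real.cos (ν * x + φ)) := by
    rw [← integral_add (Continuous.intervalIntegrable (by fun_prop) _ _)
      (Continuous.intervalIntegrable (by fun_prop) _ _), ← intervalIntegral.integral_neg]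
    refine integral_congr fun x _ => ?_
    rw [← add_sub_assoc, Real.cos_sub_pi]
    ring
  have e3 := hm.integral_mul_cos hβ hβ1 hν hp hf hper hB hk h.left φ
  have hcos := cos_periodic_of_mul_eq (ν := ν) (p := p) hk
  have e4 : ∫ x in (0 : ℝ)..p, Ir x * Real.cos (ν * x + φ) =
      ρ * ν ^ (-β) * ∫ x in (0 : ℝ)..p, f₀ x * Real.cos (ν * x + (φ - θ)) := by
    -- The right integral of `f₀` is the left integral of the reflected function, tested with the
    -- reflected phase `-φ`.
    have h1 := hm.integral_mul_cos (f := fun y => f₀ (-y)) (I := fun y => Ir (-y)) hβ hβ1 hν hp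
      (by fun_prop) (fun x => by
        simp only
        rw [← hper (-(x + p))]; ring_nf) (B := B)
      (fun r s => by rw [intervalIntegral.integral_comp_neg]; exact hB _ _) hk
      (fun y => by
        have := (hasRightFracIntegral_iff_left hβ).1 (h.right (-y))
        rwa [neg_neg] at this) (-φ)
    have h2 := ((h.periodic_right hβ hper).mul (hcos φ)).integral_comp_neg
    have h3 := (hper.mul (hcos (φ - θ))).integral_comp_neg
    simp only [Pi.mul_apply] at h2 h3
    rw [← h2, ← h3]
    have c1 : ∀ x, Real.cos (ν * -x + φ) = Real.cos (ν * x + -φ) := fun x => by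
      rw [← Real.cos_neg]; ring_nf
    have c2 : ∀ x, Real.cos (ν * -x + (φ - θ)) = Real.cos (ν * x + -φ + θ) := fun x => by
      rw [← Real.cos_neg]; ring_nf
    simp only [c1, c2]
    exact h1
  have e5 : (∫ x in (0 : ℝ)..p, f₀ x * Real.cos (ν * x + φ + θ)) +
      ∫ x in (0 : ℝ)..p, f₀ x * Real.cos (ν * x + (φ - θ)) =
      2 * Real.cos θ * ∫ x in (0 : ℝ)..p, f₀ x * Real.cos (ν * x + φ) := by
    rw [← integral_add (Continuous.intervalIntegrable (by fun_prop) _ _)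
      (Continuous.intervalIntegrable (by fun_prop) _ _), ← intervalIntegral.integral_const_mul]
    refine integral_congr fun x _ => ?_
    rw [← add_sub_assoc, Real.cos_add, Real.cos_sub]
    ring
  rw [e1, e2, e3, e4, ← mul_add, e5]
  ring

/-- The factor `μ` for which the Riesz derivative acts on waves of frequency `ν` as
multiplication by `-μ * ν ^ α`. -/
noncomputable def rieszSpeed (α σ ρ θ : ℝ) : ℝ :=
  -(σ * (ρ * Real.cos θ) / Real.cos (α * (Real.pi / 2)))

theorem cos_mul_pi_div_two_neg {α : ℝ} (h1 : 1 < α) (h2 : α ≤ 2) :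
    Real.cos (α * (Real.pi / 2)) < 0 := by
  apply Real.cos_neg_of_pi_div_two_lt_of_lt <;> nlinarith [Real.pi_pos]

theorem integral_riesz_mul_cos {α σ ρ θ : ℝ} (hα1 : 1 < α) (hα2 : α ≤ 2) (hσ : 0 < σ)
    (hm : IsFracMultiplier (2 - α) ρ θ) {f d : ℝ → ℝ} {p : ℝ} (hp : 0 < p) (hf : Continuous f)
    (hd : Continuous d) (hper : Function.Periodic f p)
    (h : ∀ x, HasRieszDerivAt α σ f (d x) x) (n : ℕ) (φ : ℝ) :
    ∫ x in (0 : ℝ)..p, d x * Real.cos (n * (2 * Real.pi / p) * x + φ) =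
      -(rieszSpeed α σ ρ θ * (n * (2 * Real.pi / p)) ^ α) *
        ∫ x in (0 : ℝ)..p, f x * Real.cos (n * (2 * Real.pi / p) * x + φ) := by
  have hcos := cos_mul_pi_div_two_neg hα1 hα2
  obtain ⟨c, f₀, Il, Ir, H', hfc, hpot⟩ := exists_isFracPotential hσ hα2 hcos hf h
  have hper₀ : Function.Periodic f₀ p := fun x => by linarith [hper x, hfc x, hfc (x + p)]
  have hβ : 0 ≤ 2 - α := by linarith
  set C := Real.cos (α * (Real.pi / 2)) with hC
  set ν := n * (2 * Real.pi / p) with hν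
  have hk : ν * p = (n : ℤ) * (2 * Real.pi) := by
    rw [hν]; push_cast; field_simp
  have hκ : -(2 * C / σ) ≠ 0 := by
    have := hcos.ne
    exact neg_ne_zero.2 (div_ne_zero (mul_ne_zero two_ne_zero this) hσ.ne')
  rcases Nat.eq_zero_or_pos n with rfl | hn
  -- For the zero mode, `d` has mean zero because `κ * d` is the derivative of the periodic function
  -- `H'`. For the other modes the constant `c` drops out.
  · have hν0 : ν = 0 := by simp [hν]
    have h1 := integral_deriv_mul_cos hk hpot.hasDerivAt' (by fun_prop)
      (hpot.periodic_deriv hβ hper₀) φ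
    simp only [mul_assoc (-(2 * C / σ)), intervalIntegral.integral_const_mul, hν0, zero_mul] at h1
    have h2 := (mul_eq_zero.1 h1).resolve_left hκ
    rw [hν0, Real.zero_rpow (by linarith)]
    simpa using h2
  have hνpos : 0 < ν := by have := Real.pi_pos; positivity
  have h1 := hpot.integral_mul_cos hm hβ (by linarith) hd hp hper₀ hk hνpos φ
  have h2 : ∫ x in (0 : ℝ)..p, Real.cos (ν * x + φ) = 0 := by
    have h3 := integral_deriv_mul_cos (G := fun _ => 1) (g := fun _ => 0) hk
      (fun x => hasDerivAt_const _ _) continuous_const (fun x => rfl) (φ + Real.pi / 2)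
    simp only [zero_mul, intervalIntegral.integral_zero, add_sub_cancel_right, one_mul] at h3
    exact (mul_eq_zero.1 h3.symm).resolve_left hνpos.ne'
  have h3 : ∫ x in (0 : ℝ)..p, f x * Real.cos (ν * x + φ) =
      ∫ x in (0 : ℝ)..p, f₀ x * Real.cos (ν * x + φ) := by
    have := hpot.continuous
    simp only [hfc, add_mul]
    rw [integral_add (Continuous.intervalIntegrable (by fun_prop) _ _)
      (Continuous.intervalIntegrable (by fun_prop) _ _), intervalIntegral.integral_const_mul, h2]
    simp
  have h4 : ν ^ 2 * ν ^ (-(2 - α)) = ν ^ α := by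
    rw [← Real.rpow_natCast, ← Real.rpow_add hνpos]; norm_num
  have h5 : ν ^ 2 * (2 * (ρ * Real.cos θ) * ν ^ (-(2 - α))) = 2 * (ρ * Real.cos θ) * ν ^ α := by
    rw [← h4]; ring
  rw [h3]
  apply mul_left_cancel₀ hκ
  rw [h1, h5, rieszSpeed, ← hC]
  have := hcos.ne
  clear_value C
  field_simp

/-! ### Evolution of the Fourier coefficients -/

/-- `W` is periodic in space and solves the evolution equation, with Riesz derivative `D`, except
that the time derivative is only considered at the non-integer points. -/
structure IsPeriodicEvolution (α σ T p : ℝ) (W D : ℝ → ℝ → ℝ) : Prop where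
  pos : 0 < p
  periodic : ∀ t ∈ Ico 0 T, Function.Periodic (W t) p
  continuousOn : ContinuousOn (Function.uncurry W) (Ico 0 T ×ˢ univ)
  continuousOn' : ContinuousOn (Function.uncurry D) (Ioo 0 T ×ˢ univ)
  riesz : ∀ t ∈ Ioo 0 T, ∀ x : ℝ, HasRieszDerivAt α σ (W t) (D t x) x
  hasDerivAt : ∀ t ∈ Ioo 0 T, ∀ x ∉ range ((↑) : ℤ → ℝ), HasDerivAt (fun s => W s x) (D t x) t

theorem continuous_slice {W : ℝ → ℝ → ℝ} {S : Set ℝ}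
    (h : ContinuousOn (Function.uncurry W) (S ×ˢ univ)) {t : ℝ} (ht : t ∈ S) :
    Continuous (W t) :=
  h.comp_continuous (f := fun x => (t, x)) (by fun_prop) fun _ => ⟨ht, trivial⟩

namespace IsPeriodicEvolution

variable {α σ T p : ℝ} {W D : ℝ → ℝ → ℝ}

theorem continuousOn_integral (h : IsPeriodicEvolution α σ T p W D) {t : ℝ} (ht : t ∈ Ico 0 T)
    {g : ℝ → ℝ} (hg : Continuous g) :
    ContinuousOn (fun s => ∫ x in (0 : ℝ)..p, W s x * g x) (Icc 0 t) := by
  -- Clamping the time to `[0, t]` makes the integrand continuous on the whole plane without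
  -- changing it where it matters.
  have hclamp : Continuous (Function.uncurry fun s x => W (max 0 (min s t)) x) :=
    h.continuousOn.comp_continuous (f := fun z : ℝ × ℝ => (max 0 (min z.1 t), z.2))
      (by fun_prop) fun z => ⟨⟨le_max_left _ _, max_lt (ht.1.trans_lt ht.2)
        ((min_le_right _ _).trans_lt ht.2)⟩, trivial⟩
  have hc : Continuous (Function.uncurry fun s x => W (max 0 (min s t)) x * g x) :=
    hclamp.mul (by fun_prop)
  refine (continuous_parametric_intervalIntegral_of_continuous' (μ := volume) hc 0 p
    ).continuousOn.congr fun s hs => ?_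
  simp only [min_eq_left hs.2, max_eq_right hs.1]

theorem hasDerivAt_integral (h : IsPeriodicEvolution α σ T p W D) {t : ℝ} (ht : t ∈ Ioo 0 T)
    {g : ℝ → ℝ} (hg : Continuous g) :
    HasDerivAt (fun s => ∫ x in (0 : ℝ)..p, W s x * g x) (∫ x in (0 : ℝ)..p, D t x * g x) t := by
  obtain ⟨a, ha0, hat⟩ := exists_between ht.1
  obtain ⟨b, htb, hbT⟩ := exists_between ht.2
  have hsub : Icc a b ⊆ Ioo 0 T := fun s hs => ⟨ha0.trans_le hs.1, hs.2.trans_lt hbT⟩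
  have hcW : ∀ s ∈ Ioo 0 T, Continuous (W s) := fun s hs =>
    continuous_slice h.continuousOn ⟨hs.1.le, hs.2⟩
  have hcD : ∀ s ∈ Ioo 0 T, Continuous (D s) := fun s hs => continuous_slice h.continuousOn' hs
  obtain ⟨K, hK⟩ : ∃ K, ∀ z ∈ Icc a b ×ˢ Icc 0 p, ‖Function.uncurry D z * g z.2‖ ≤ K := by
    refine (isCompact_Icc.prod isCompact_Icc).exists_bound_of_continuousOn ?_
    exact (h.continuousOn'.mono (prod_mono hsub (subset_univ _))).mul (by fun_prop)
  refine (hasDerivAt_integral_of_dominated_loc_of_deriv_le (bound := fun _ => K)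
    (F := fun s x => W s x * g x) (F' := fun s x => D s x * g x)
    (Icc_mem_nhds hat htb) ?_ ?_ ?_ ?_ intervalIntegrable_const ?_).2
  · filter_upwards [Ioo_mem_nhds ht.1 ht.2] with s hs
    have := hcW s hs
    exact Continuous.aestronglyMeasurable (by fun_prop)
  · have := hcW t ht
    exact Continuous.intervalIntegrable (by fun_prop) _ _
  · have := hcD t ht
    exact Continuous.aestronglyMeasurable (by fun_prop)
  · refine Eventually.of_forall fun x hx s hs => ?_
    rw [uIoc_of_le h.pos.le] at hx
    exact hK (s, x) ⟨hs, hx.1.le, hx.2⟩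
  -- The equation may be missing at the integers, which do not affect the integral.
  · have hnull : ∀ᵐ x : ℝ, x ∉ range ((↑) : ℤ → ℝ) :=
      (countable_range _).ae_notMem _
    filter_upwards [hnull] with x hx _ s hs
    exact (h.hasDerivAt s (hsub hs) x hx).mul_const _

theorem integral_mul_cos (h : IsPeriodicEvolution α σ T p W D) {ρ θ : ℝ} (hα1 : 1 < α)
    (hα2 : α ≤ 2) (hσ : 0 < σ) (hm : IsFracMultiplier (2 - α) ρ θ) (n : ℕ) (φ : ℝ) {t : ℝ}
    (ht : t ∈ Ico 0 T) :
    ∫ x in (0 : ℝ)..p, W t x * Real.cos (n * (2 * Real.pi / p) * x + φ) =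
      Real.exp (-(rieszSpeed α σ ρ θ * (n * (2 * Real.pi / p)) ^ α) * t) *
        ∫ x in (0 : ℝ)..p, W 0 x * Real.cos (n * (2 * Real.pi / p) * x + φ) := by
  set l := rieszSpeed α σ ρ θ * (n * (2 * Real.pi / p)) ^ α with hl
  set g : ℝ → ℝ := fun x => Real.cos (n * (2 * Real.pi / p) * x + φ) with hg
  have hgc : Continuous g := by fun_prop
  rcases ht.1.eq_or_lt with rfl | ht0
  · simp
  have hderiv : ∀ s ∈ Ioo 0 t, HasDerivAt (fun s => Real.exp (l * s) *
      ∫ x in (0 : ℝ)..p, W s x * g x) 0 s := by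
    intro s hs
    have hs' : s ∈ Ioo 0 T := ⟨hs.1, hs.2.trans ht.2⟩
    have h1 := h.hasDerivAt_integral hs' hgc
    rw [integral_riesz_mul_cos hα1 hα2 hσ hm h.pos
      (continuous_slice h.continuousOn ⟨hs'.1.le, hs'.2⟩) (continuous_slice h.continuousOn' hs')
      (h.periodic s ⟨hs'.1.le, hs'.2⟩) (h.riesz s hs') n φ, ← hl] at h1
    have h2 : HasDerivAt (fun s => Real.exp (l * s)) (Real.exp (l * s) * l) s := by
      have h3 : HasDerivAt (fun s : ℝ => l * s) l s := by
        simpa using (hasDerivAt_id s).const_mul l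
      exact h3.exp
    refine (h2.mul h1).congr_deriv ?_
    ring
  -- No derivative is available at time `0`; continuity up to it lets the mean value theorem show
  -- that this product is constant.
  have hcont : ContinuousOn (fun s => Real.exp (l * s) * ∫ x in (0 : ℝ)..p, W s x * g x)
      (Icc 0 t) := ContinuousOn.mul (by fun_prop) (h.continuousOn_integral ht hgc)
  obtain ⟨c, hc, hc'⟩ := exists_hasDerivAt_eq_slope _ _ ht0 hcont hderiv
  rw [eq_comm, div_eq_zero_iff] at hc'
  have h4 := hc'.resolve_right (by linarith)
  rw [mul_zero, Real.exp_zero, one_mul, sub_eq_zero] at h4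
  rw [← h4, ← mul_assoc, ← Real.exp_add]
  simp [hg]

end IsPeriodicEvolution

/-- The phases `0` and `π / 2` together yield the complex exponentials. Vanishing coefficients are
summable, so the Fourier series converges pointwise to `f`. -/
theorem eq_zero_of_integral_mul_cos {f : ℝ → ℝ} {p : ℝ} (hp : 0 < p) (hf : Continuous f)
    (hper : Function.Periodic f p)
    (h : ∀ (n : ℕ) (φ : ℝ), ∫ x in (0 : ℝ)..p, f x * Real.cos (n * (2 * Real.pi / p) * x + φ) = 0)
    (x : ℝ) : f x = 0 := by
  have hZ : ∀ (n : ℤ) (φ : ℝ),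
      ∫ x in (0 : ℝ)..p, f x * Real.cos (n * (2 * Real.pi / p) * x + φ) = 0 := by
    intro n φ
    obtain ⟨m, rfl | rfl⟩ := n.eq_nat_or_neg
    · exact_mod_cast h m φ
    · refine Eq.trans (integral_congr fun x _ => ?_) (h m (-φ))
      rw [← Real.cos_neg]
      push_cast
      ring_nf
  have : Fact (0 < p) := ⟨hp⟩
  set F : C(AddCircle p, ℂ) := ⟨fun z => ((hper.lift z : ℝ) : ℂ),
    Complex.continuous_ofReal.comp (continuous_quot_lift _ hf)⟩ with hF
  have hFx : ∀ y : ℝ, F (y : AddCircle p) = f y := fun y => rfl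
  have hcoef : fourierCoeff (F : AddCircle p → ℂ) = 0 := by
    funext n
    rw [fourierCoeff_eq_intervalIntegral _ n 0, zero_add]
    have e : ∀ y : ℝ, (fourier (-n) (y : AddCircle p) : ℂ) • F (y : AddCircle p) =
        ((f y * Real.cos (n * (2 * Real.pi / p) * y + 0) : ℝ) : ℂ) +
        Complex.I * ((f y * Real.cos (n * (2 * Real.pi / p) * y + Real.pi / 2) : ℝ) : ℂ) := by
      intro y
      rw [hFx, fourier_coe_apply, Real.cos_add_pi_div_two, add_zero]
      have : 2 * (Real.pi : ℂ) * Complex.I * ((-n : ℤ) : ℂ) * y / p =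
          ((-(n * (2 * Real.pi / p) * y) : ℝ) : ℂ) * Complex.I := by
        push_cast; ring
      rw [this, Complex.exp_mul_I, ← Complex.ofReal_cos, ← Complex.ofReal_sin, Real.cos_neg,
        Real.sin_neg, smul_eq_mul]
      push_cast
      ring
    simp only [e]
    rw [intervalIntegral.integral_add, intervalIntegral.integral_const_mul,
      intervalIntegral.integral_ofReal,
      intervalIntegral.integral_ofReal, hZ, hZ]
    · simp
    · exact Continuous.intervalIntegrable (by fun_prop) _ _
    · exact Continuous.intervalIntegrable (by fun_prop) _ _
  have hs := has_pointwise_sum_fourier_series_of_summable (f := F)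
    (by rw [hcoef]; exact summable_zero) (x : AddCircle p)
  rw [hcoef] at hs
  simp only [Pi.zero_apply, zero_smul] at hs
  have := hs.unique hasSum_zero
  rw [hFx] at this
  exact_mod_cast this

theorem IsPeriodicEvolution.unique {α σ T p : ℝ} (hα1 : 1 < α) (hα2 : α ≤ 2) (hσ : 0 < σ)
    {W D W' D' : ℝ → ℝ → ℝ} (h : IsPeriodicEvolution α σ T p W D)
    (h' : IsPeriodicEvolution α σ T p W' D') (h0 : ∀ x, W 0 x = W' 0 x) {t : ℝ}
    (ht : t ∈ Ico 0 T) (x : ℝ) : W t x = W' t x := by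
  obtain ⟨ρ, θ, -, hm⟩ := exists_isFracMultiplier (β := 2 - α) (by linarith) (by linarith)
  have hc := continuous_slice h.continuousOn ht
  have hc' := continuous_slice h'.continuousOn ht
  refine sub_eq_zero.1 (eq_zero_of_integral_mul_cos h.pos (f := fun x => W t x - W' t x)
    (by fun_prop) ((h.periodic t ht).sub (h'.periodic t ht)) (fun n φ => ?_) x)
  simp only [sub_mul]
  rw [integral_sub (Continuous.intervalIntegrable (by fun_prop) _ _)
    (Continuous.intervalIntegrable (by fun_prop) _ _), h.integral_mul_cos hα1 hα2 hσ hm n φ ht,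
    h'.integral_mul_cos hα1 hα2 hσ hm n φ ht, funext h0, sub_self]

/-! ### The maximum principle for cosine sums -/

theorem integrableOn_one_sub_cos_mul_rpow {α : ℝ} (h1 : 1 < α) (h2 : α < 2) :
    IntegrableOn (fun s => (1 - Real.cos s) * s ^ (-1 - α)) (Ioi 0) := by
  have hmeas : Measurable fun s : ℝ => (1 - Real.cos s) * s ^ (-1 - α) := by fun_prop
  rw [← Ioc_union_Ioi_eq_Ioi zero_le_one, integrableOn_union]
  constructor
  · have hI : IntegrableOn (fun s : ℝ => s ^ (1 - α)) (Ioc 0 1) :=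
      (intervalIntegrable_iff_integrableOn_Ioc_of_le zero_le_one).1
        (intervalIntegrable_rpow' (by linarith))
    refine hI.mono' hmeas.aestronglyMeasurable ?_
    refine (ae_restrict_mem measurableSet_Ioc).mono fun s hs => ?_
    have hs0 := Real.rpow_nonneg hs.1.le (-1 - α)
    have e : s ^ (1 - α) = s ^ 2 * s ^ (-1 - α) := by
      rw [← Real.rpow_natCast, ← Real.rpow_add hs.1]; norm_num; ring_nf
    rw [Real.norm_eq_abs, abs_of_nonneg (mul_nonneg (by linarith [Real.cos_le_one s]) hs0), e]
    refine mul_le_mul_of_nonneg_right ?_ hs0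
    nlinarith [Real.one_sub_sq_div_two_le_cos (x := s)]
  · have hI : IntegrableOn (fun s : ℝ => 2 * s ^ (-1 - α)) (Ioi 1) :=
      (integrableOn_Ioi_rpow_of_lt (by linarith) one_pos).const_mul 2
    refine hI.mono' hmeas.aestronglyMeasurable ?_
    refine (ae_restrict_mem measurableSet_Ioi).mono fun s hs => ?_
    have hs0 := Real.rpow_nonneg (one_pos.trans (mem_Ioi.1 hs)).le (-1 - α)
    rw [Real.norm_eq_abs, abs_of_nonneg (mul_nonneg (by linarith [Real.cos_le_one s]) hs0)]
    exact mul_le_mul_of_nonneg_right (by linarith [Real.neg_one_le_cos s]) hs0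

theorem integral_one_sub_cos_mul_rpow_pos {α : ℝ} (h1 : 1 < α) (h2 : α < 2) :
    0 < ∫ s in Ioi (0 : ℝ), (1 - Real.cos s) * s ^ (-1 - α) := by
  have hI := integrableOn_one_sub_cos_mul_rpow h1 h2
  have hnn : ∀ s ∈ Ioi (0 : ℝ), 0 ≤ (1 - Real.cos s) * s ^ (-1 - α) := fun s hs =>
    mul_nonneg (by linarith [Real.cos_le_one s]) (Real.rpow_nonneg (mem_Ioi.1 hs).le _)
  have hsub : Ioc (0 : ℝ) 1 ⊆ Ioi 0 := fun s hs => hs.1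
  have h3 : 0 < ∫ s in (0 : ℝ)..1, (1 - Real.cos s) * s ^ (-1 - α) := by
    refine intervalIntegral_pos_of_pos_on
      ((intervalIntegrable_iff_integrableOn_Ioc_of_le zero_le_one).2 (hI.mono_set hsub)) ?_ one_pos
    intro s hs
    refine mul_pos ?_ (Real.rpow_pos_of_pos hs.1 _)
    have : Real.cos s < Real.cos 0 := Real.cos_lt_cos_of_nonneg_of_le_pi le_rfl
      (by linarith [hs.2, Real.pi_gt_three]) hs.1
    rw [Real.cos_zero] at this
    linarith
  rw [integral_of_le zero_le_one] at h3
  exact h3.trans_le (setIntegral_mono_set hI ((ae_restrict_mem measurableSet_Ioi).mono hnn)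
    hsub.eventuallyLE)

/-- Scaling writes the symbol `ν ^ α` as a positive superposition of the symbols `1 - cos (ν * s)`
of second differences. -/
theorem integral_one_sub_cos_mul {α ν : ℝ} (h1 : 1 < α) (h2 : α < 2) (hν : 0 ≤ ν) :
    IntegrableOn (fun s => (1 - Real.cos (ν * s)) * s ^ (-1 - α)) (Ioi 0) ∧
    ∫ s in Ioi (0 : ℝ), (1 - Real.cos (ν * s)) * s ^ (-1 - α) =
      ν ^ α * ∫ s in Ioi (0 : ℝ), (1 - Real.cos s) * s ^ (-1 - α) := by
  rcases hν.eq_or_lt with rfl | hν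
  · simp [Real.zero_rpow (show α ≠ 0 by linarith)]
  have hcongr : ∀ s ∈ Ioi (0 : ℝ), (1 - Real.cos (ν * s)) * s ^ (-1 - α) =
      ν ^ (1 + α) * ((1 - Real.cos (ν * s)) * (ν * s) ^ (-1 - α)) := fun s hs => by
    rw [Real.mul_rpow hν.le (mem_Ioi.1 hs).le, mul_left_comm, ← mul_assoc (ν ^ (1 + α)),
      ← Real.rpow_add hν]
    norm_num
  constructor
  · have h3 : IntegrableOn (fun s => (1 - Real.cos (ν * s)) * (ν * s) ^ (-1 - α)) (Ioi 0) := by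
      have := (integrableOn_Ioi_comp_mul_left_iff
        (fun s => (1 - Real.cos s) * s ^ (-1 - α)) 0 hν).2
      rw [mul_zero] at this
      exact this (integrableOn_one_sub_cos_mul_rpow h1 h2)
    exact IntegrableOn.congr_fun (h3.const_mul (ν ^ (1 + α))) (fun s hs => (hcongr s hs).symm)
      measurableSet_Ioi
  · rw [setIntegral_congr_fun measurableSet_Ioi hcongr, MeasureTheory.integral_const_mul,
      integral_comp_mul_left_Ioi (fun s => (1 - Real.cos s) * s ^ (-1 - α)) 0 hν, mul_zero,
      smul_eq_mul, ← mul_assoc, Real.rpow_add hν, Real.rpow_one]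
    congr 1
    field_simp

/-- At a maximum point all differences `2 f(x₀) - f(x₀ + r) - f(x₀ - r)` are nonnegative;
integrating them against `r ^ (-1 - α)` gives a positive multiple of the sum. -/
theorem sum_rpow_mul_cos_nonneg_of_lt_two {α : ℝ} (h1 : 1 < α) (h2 : α < 2) (s : Finset ℕ)
    (b : ℕ → ℝ) {x₀ : ℝ}
    (hmax : ∀ x, ∑ n ∈ s, b n * Real.cos (n * Real.pi * x) ≤
      ∑ n ∈ s, b n * Real.cos (n * Real.pi * x₀)) :
    0 ≤ ∑ n ∈ s, (n * Real.pi) ^ α * (b n * Real.cos (n * Real.pi * x₀)) := by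
  have hpi := Real.pi_pos
  set c := ∫ s in Ioi (0 : ℝ), (1 - Real.cos s) * s ^ (-1 - α) with hc
  have hcpos : 0 < c := integral_one_sub_cos_mul_rpow_pos h1 h2
  have hI := fun n : ℕ => integral_one_sub_cos_mul (ν := n * Real.pi) h1 h2 (by positivity)
  have key : (∑ n ∈ s, (n * Real.pi) ^ α * (b n * Real.cos (n * Real.pi * x₀))) * c =
      ∫ r in Ioi (0 : ℝ), ∑ n ∈ s, b n * Real.cos (n * Real.pi * x₀) *
        ((1 - Real.cos (n * Real.pi * r)) * r ^ (-1 - α)) := by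
    rw [integral_finsetSum _ fun n _ => (hI n).1.const_mul _, Finset.sum_mul]
    refine Finset.sum_congr rfl fun n _ => ?_
    rw [MeasureTheory.integral_const_mul, (hI n).2]
    ring
  refine nonneg_of_mul_nonneg_left ?_ hcpos
  rw [key]
  refine setIntegral_nonneg measurableSet_Ioi fun r hr => ?_
  have e : ∑ n ∈ s, b n * Real.cos (n * Real.pi * x₀) *
        ((1 - Real.cos (n * Real.pi * r)) * r ^ (-1 - α)) =
      ((∑ n ∈ s, b n * Real.cos (n * Real.pi * x₀)) -
        (∑ n ∈ s, b n * Real.cos (n * Real.pi * (x₀ + r)) +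
         ∑ n ∈ s, b n * Real.cos (n * Real.pi * (x₀ - r))) / 2) * r ^ (-1 - α) := by
    rw [← Finset.sum_add_distrib, Finset.sum_div, ← Finset.sum_sub_distrib, Finset.sum_mul]
    refine Finset.sum_congr rfl fun n _ => ?_
    rw [mul_add, mul_sub, Real.cos_add, Real.cos_sub]
    ring
  rw [e]
  refine mul_nonneg ?_ (Real.rpow_nonneg (mem_Ioi.1 hr).le _)
  linarith [hmax (x₀ + r), hmax (x₀ - r)]

/-- For `α = 2` the integral representation diverges at `0`, so this case is the limit `α ↑ 2` of
finite sums. -/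
theorem sum_rpow_mul_cos_nonneg {α : ℝ} (h1 : 1 < α) (h2 : α ≤ 2) (s : Finset ℕ)
    (b : ℕ → ℝ) {x₀ : ℝ}
    (hmax : ∀ x, ∑ n ∈ s, b n * Real.cos (n * Real.pi * x) ≤
      ∑ n ∈ s, b n * Real.cos (n * Real.pi * x₀)) :
    0 ≤ ∑ n ∈ s, (n * Real.pi) ^ α * (b n * Real.cos (n * Real.pi * x₀)) := by
  rcases h2.lt_or_eq with h2 | rfl
  · exact sum_rpow_mul_cos_nonneg_of_lt_two h1 h2 s b hmax
  have ht : Tendsto (fun a : ℝ => ∑ n ∈ s, (n * Real.pi) ^ a *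
      (b n * Real.cos (n * Real.pi * x₀))) (𝓝[<] 2)
      (𝓝 (∑ n ∈ s, (n * Real.pi) ^ (2 : ℝ) * (b n * Real.cos (n * Real.pi * x₀)))) := by
    refine Tendsto.mono_left ?_ nhdsWithin_le_nhds
    refine tendsto_finsetSum _ fun n _ => Tendsto.mul_const _ ?_
    exact (Real.continuousAt_const_rpow' two_ne_zero).tendsto
  refine ge_of_tendsto ht ?_
  filter_upwards [Ioo_mem_nhdsLT (show (1 : ℝ) < 2 from one_lt_two)] with a ha
  exact sum_rpow_mul_cos_nonneg_of_lt_two ha.1 ha.2 s b hmax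

theorem cos_nat_mul_pi_periodic (n : ℕ) : Function.Periodic (fun x => Real.cos (n * Real.pi * x)) 2 :=
  fun x => by
    simp only
    rw [show n * Real.pi * (x + 2) = n * Real.pi * x + n * (2 * Real.pi) by ring,
      Real.cos_add_nat_mul_two_pi]

/-- The resolvent of the generator is a contraction for the maximum norm. -/
theorem sum_div_one_add_mul_cos_le {α : ℝ} (h1 : 1 < α) (h2 : α ≤ 2) (s : Finset ℕ)
    (a : ℕ → ℝ) {h M : ℝ} (hh : 0 ≤ h)
    (hM : ∀ x, ∑ n ∈ s, a n * Real.cos (n * Real.pi * x) ≤ M) (x : ℝ) :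
    ∑ n ∈ s, a n / (1 + h * (n * Real.pi) ^ α) * Real.cos (n * Real.pi * x) ≤ M := by
  have hpi := Real.pi_pos
  set b : ℕ → ℝ := fun n => a n / (1 + h * (n * Real.pi) ^ α) with hb
  set Q : ℝ → ℝ := fun x => ∑ n ∈ s, b n * Real.cos (n * Real.pi * x) with hQ
  have hQc : Continuous Q := by fun_prop
  have hQp : Function.Periodic Q 2 := fun x =>
    Finset.sum_congr rfl fun n _ => congrArg (b n * ·) (cos_nat_mul_pi_periodic n x)
  obtain ⟨x₀, -, hx₀⟩ := isCompact_Icc.exists_isMaxOn (nonempty_Icc.2 (zero_le_two (α := ℝ)))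
    hQc.continuousOn
  have hmax : ∀ x, Q x ≤ Q x₀ := fun x => by
    obtain ⟨y, hy, hxy⟩ := hQp.exists_mem_Ico₀ two_pos x
    rw [hxy]
    exact hx₀ (Ico_subset_Icc_self hy)
  refine (hmax x).trans (le_trans ?_ (hM x₀))
  -- With `A` the multiplier by `(n * π) ^ α`, the given sum is `Q + h * A Q`. At the maximum `x₀`
  -- of `Q` one has `A Q ≥ 0`, so `Q x₀` is at most the given sum there.
  have e : ∑ n ∈ s, a n * Real.cos (n * Real.pi * x₀) =
      Q x₀ + h * ∑ n ∈ s, (n * Real.pi) ^ α * (b n * Real.cos (n * Real.pi * x₀)) := by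
    rw [Finset.mul_sum, ← Finset.sum_add_distrib]
    refine Finset.sum_congr rfl fun n _ => ?_
    have hne : 1 + h * (n * Real.pi) ^ α ≠ 0 := by positivity
    have : a n = b n * (1 + h * (n * Real.pi) ^ α) := by rw [hb]; field_simp
    rw [this]
    ring
  rw [e]
  exact le_add_of_nonneg_right (mul_nonneg hh (sum_rpow_mul_cos_nonneg h1 h2 s b hmax))

/-- Exponential formula: `m` resolvent steps of size `h / m` preserve the upper bound, and `(1 + h *
a / m) ^ (-m)` tends to `exp (-h * a)` in each of the finitely many modes. -/
theorem sum_exp_mul_cos_le {α : ℝ} (h1 : 1 < α) (h2 : α ≤ 2) (s : Finset ℕ)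
    (a : ℕ → ℝ) {h M : ℝ} (hh : 0 ≤ h)
    (hM : ∀ x, ∑ n ∈ s, a n * Real.cos (n * Real.pi * x) ≤ M) (x : ℝ) :
    ∑ n ∈ s, a n * Real.exp (-(h * (n * Real.pi) ^ α)) * Real.cos (n * Real.pi * x) ≤ M := by
  have hpi := Real.pi_pos
  have hiter : ∀ (m k : ℕ) (x : ℝ), ∑ n ∈ s, a n / (1 + h / m * (n * Real.pi) ^ α) ^ k *
      Real.cos (n * Real.pi * x) ≤ M := by
    intro m k
    induction k with
    | zero => simpa using hM
    | succ k ih =>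
      intro x
      have := sum_div_one_add_mul_cos_le h1 h2 s _ (div_nonneg hh m.cast_nonneg) ih x
      simpa only [div_div, ← pow_succ] using this
  have ht : Tendsto (fun m : ℕ => ∑ n ∈ s, a n / (1 + h / m * (n * Real.pi) ^ α) ^ m *
      Real.cos (n * Real.pi * x)) atTop
      (𝓝 (∑ n ∈ s, a n * Real.exp (-(h * (n * Real.pi) ^ α)) * Real.cos (n * Real.pi * x))) := by
    refine tendsto_finsetSum _ fun n _ => Tendsto.mul_const _ ?_
    rw [Real.exp_neg, ← div_eq_mul_inv]
    refine Tendsto.div tendsto_const_nhds ?_ (Real.exp_pos _).ne'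
    refine (Real.tendsto_one_add_div_pow_exp (h * (n * Real.pi) ^ α)).congr fun m => ?_
    rw [mul_div_right_comm]
  exact le_of_tendsto ht (Eventually.of_forall fun m => hiter m m x)

theorem abs_sum_exp_mul_cos_le {α : ℝ} (h1 : 1 < α) (h2 : α ≤ 2) (s : Finset ℕ)
    (a : ℕ → ℝ) {h M : ℝ} (hh : 0 ≤ h)
    (hM : ∀ x, |∑ n ∈ s, a n * Real.cos (n * Real.pi * x)| ≤ M) (x : ℝ) :
    |∑ n ∈ s, a n * Real.exp (-(h * (n * Real.pi) ^ α)) * Real.cos (n * Real.pi * x)| ≤ M := by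
  rw [abs_le']
  refine ⟨sum_exp_mul_cos_le h1 h2 s a hh (fun x => (abs_le'.1 (hM x)).1) x, ?_⟩
  have := sum_exp_mul_cos_le h1 h2 s (fun n => -a n) hh (M := M)
    (fun x => by simpa only [neg_mul, Finset.sum_neg_distrib] using (abs_le'.1 (hM x)).2) x
  simpa only [neg_mul, Finset.sum_neg_distrib] using this

/-! ### The even periodic extension -/

theorem exists_neumannExt_point (x : ℝ) : ∃ y ∈ Icc (0 : ℝ) 1, (∀ w, neumannExt w x = w y) ∧
    ∃ k : ℤ, x = y + k * 2 ∨ x = -y + k * 2 := by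
  refine ⟨|x - 2 * (round (x / 2) : ℝ)|, ⟨abs_nonneg _, ?_⟩, fun w => rfl, round (x / 2), ?_⟩
  · have h := abs_sub_round (x / 2)
    have : x - 2 * (round (x / 2) : ℝ) = 2 * (x / 2 - round (x / 2)) := by ring
    rw [this, abs_mul, abs_two]
    linarith
  · rcases abs_choice (x - 2 * (round (x / 2) : ℝ)) with h | h <;> rw [h]
    · left; ring
    · right; ring

/-- This formula makes evenness, period 2 and continuity of the extension immediate. -/
theorem neumannExt_eq_arccos (w : ℝ → ℝ) (x : ℝ) :
    neumannExt w x = w (Real.arccos (Real.cos (Real.pi * x)) / Real.pi) := by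
  have hpi := Real.pi_pos
  obtain ⟨y, hy, hw, k, hk⟩ := exists_neumannExt_point x
  have : Real.cos (Real.pi * x) = Real.cos (Real.pi * y) := by
    rcases hk with rfl | rfl
    · rw [show Real.pi * (y + k * 2) = Real.pi * y + k * (2 * Real.pi) by ring,
        Real.cos_add_int_mul_two_pi]
    · rw [show Real.pi * (-y + k * 2) = -(Real.pi * y) + k * (2 * Real.pi) by ring,
        Real.cos_add_int_mul_two_pi, Real.cos_neg]
  rw [hw, this, Real.arccos_cos (by nlinarith [hy.1]) (by nlinarith [hy.2]),
    mul_div_cancel_left₀ _ hpi.ne']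

theorem neumannExt_neg (w : ℝ → ℝ) (x : ℝ) : neumannExt w (-x) = neumannExt w x := by
  rw [neumannExt_eq_arccos, neumannExt_eq_arccos, mul_neg, Real.cos_neg]

theorem neumannExt_periodic (w : ℝ → ℝ) : Function.Periodic (neumannExt w) 2 := fun x => by
  rw [neumannExt_eq_arccos, neumannExt_eq_arccos, mul_add, mul_comm Real.pi 2,
    Real.cos_add_two_pi]

theorem neumannExt_of_mem {w : ℝ → ℝ} {x : ℝ} (hx : x ∈ Icc (0 : ℝ) 1) :
    neumannExt w x = w x := by
  have hpi := Real.pi_pos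
  rw [neumannExt_eq_arccos, Real.arccos_cos (by nlinarith [hx.1]) (by nlinarith [hx.2]),
    mul_div_cancel_left₀ _ hpi.ne']

theorem arccos_div_pi_mem (y : ℝ) : Real.arccos y / Real.pi ∈ Icc (0 : ℝ) 1 :=
  ⟨div_nonneg (Real.arccos_nonneg _) Real.pi_pos.le,
    (div_le_one Real.pi_pos).2 (Real.arccos_le_pi _)⟩

theorem neumannExt_of_even {f : ℝ → ℝ} (he : ∀ x, f (-x) = f x) (hp : Function.Periodic f 2)
    (x : ℝ) : neumannExt f x = f x := by
  obtain ⟨y, hy, hw, k, hk⟩ := exists_neumannExt_point x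
  rw [hw]
  rcases hk with rfl | rfl
  · exact (hp.int_mul k y).symm
  · rw [hp.int_mul k (-y), he]

theorem continuous_neumannExt {w : ℝ → ℝ} (hw : ContinuousOn w (Icc 0 1)) :
    Continuous (neumannExt w) := by
  rw [funext (neumannExt_eq_arccos w)]
  exact hw.comp_continuous (by fun_prop) fun x => arccos_div_pi_mem _

theorem continuousOn_neumannExt {v : ℝ → ℝ → ℝ} {S : Set ℝ}
    (hv : ContinuousOn (Function.uncurry v) (S ×ˢ Icc 0 1)) :
    ContinuousOn (Function.uncurry fun t x => neumannExt (v t) x) (S ×ˢ univ) := by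
  have h : (Function.uncurry fun t x => neumannExt (v t) x) =
      Function.uncurry v ∘ fun z : ℝ × ℝ =>
        (z.1, Real.arccos (Real.cos (Real.pi * z.2)) / Real.pi) := by
    funext z
    exact neumannExt_eq_arccos _ _
  rw [h]
  exact hv.comp (by fun_prop) fun z hz => ⟨hz.1, arccos_div_pi_mem _⟩

/-! ### Cosine polynomials -/

theorem exists_finset_sum_of_mem_span {f : ℝ → ℝ}
    (hf : f ∈ Submodule.span ℝ (range fun (n : ℕ) (x : ℝ) => Real.cos (n * Real.pi * x))) :
    ∃ (s : Finset ℕ) (b : ℕ → ℝ), ∀ x, f x = ∑ n ∈ s, b n * Real.cos (n * Real.pi * x) := by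
  obtain ⟨c, rfl⟩ := (Finsupp.mem_span_range_iff_exists_finsupp).1 hf
  refine ⟨c.support, c, fun x => ?_⟩
  simp [Finsupp.sum, Finset.sum_apply]

theorem cos_mul_mem_span {f : ℝ → ℝ}
    (hf : f ∈ Submodule.span ℝ (range fun (n : ℕ) (x : ℝ) => Real.cos (n * Real.pi * x))) :
    (fun x => Real.cos (Real.pi * x) * f x) ∈
      Submodule.span ℝ (range fun (n : ℕ) (x : ℝ) => Real.cos (n * Real.pi * x)) := by
  suffices h : Submodule.span ℝ (range fun (n : ℕ) (x : ℝ) => Real.cos (n * Real.pi * x)) ≤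
      (Submodule.span ℝ (range fun (n : ℕ) (x : ℝ) => Real.cos (n * Real.pi * x))).comap
        (LinearMap.mulLeft ℝ fun x => Real.cos (Real.pi * x)) from h hf
  rw [Submodule.span_le]
  rintro _ ⟨n, rfl⟩
  change (fun x => Real.cos (Real.pi * x) * Real.cos (n * Real.pi * x)) ∈ Submodule.span ℝ _
  rcases n with _ | n
  · refine Submodule.subset_span ⟨1, ?_⟩
    funext x
    simp
  · have h : (fun x => Real.cos (Real.pi * x) * Real.cos ((n + 1 : ℕ) * Real.pi * x)) =
        (1 / 2 : ℝ) • ((fun x => Real.cos ((n + 2 : ℕ) * Real.pi * x)) +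
          fun x => Real.cos (n * Real.pi * x)) := by
      funext x
      simp only [Pi.smul_apply, Pi.add_apply, smul_eq_mul]
      rw [show ((n + 2 : ℕ) : ℝ) * Real.pi * x = (n + 1 : ℕ) * Real.pi * x + Real.pi * x by
        push_cast; ring, show (n : ℝ) * Real.pi * x = (n + 1 : ℕ) * Real.pi * x - Real.pi * x by
        push_cast; ring, Real.cos_add, Real.cos_sub]
      ring
    rw [h]
    exact Submodule.smul_mem _ _ (Submodule.add_mem _ (Submodule.subset_span ⟨n + 2, rfl⟩)
      (Submodule.subset_span ⟨n, rfl⟩))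

theorem polynomial_eval_cos_mem_span (q : Polynomial ℝ) :
    (fun x => q.eval (Real.cos (Real.pi * x))) ∈
      Submodule.span ℝ (range fun (n : ℕ) (x : ℝ) => Real.cos (n * Real.pi * x)) := by
  have hpow : ∀ k : ℕ, (fun x => Real.cos (Real.pi * x) ^ k) ∈
      Submodule.span ℝ (range fun (n : ℕ) (x : ℝ) => Real.cos (n * Real.pi * x)) := by
    intro k
    induction k with
    | zero => exact Submodule.subset_span ⟨0, by funext x; simp⟩
    | succ k ih =>
      have := cos_mul_mem_span ih
      simpa only [pow_succ'] using this
  have h : (fun x => q.eval (Real.cos (Real.pi * x))) =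
      ∑ i ∈ Finset.range (q.natDegree + 1), q.coeff i • fun x => Real.cos (Real.pi * x) ^ i := by
    funext x
    simp [Polynomial.eval_eq_sum_range, Finset.sum_apply]
  rw [h]
  exact Submodule.sum_mem _ fun i _ => Submodule.smul_mem _ _ (hpow i)

/-- The substitution `y = cos (π * x)` identifies `[0, 1]` with `[-1, 1]`. Weierstrass approximation
gives a polynomial in `cos (π * x)`, which is a cosine sum by the product formula. -/
theorem exists_cos_sum_near {w : ℝ → ℝ} (hw : ContinuousOn w (Icc 0 1)) {ε : ℝ} (hε : 0 < ε) :
    ∃ (s : Finset ℕ) (b : ℕ → ℝ), ∀ x ∈ Icc (0 : ℝ) 1,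
      |w x - ∑ n ∈ s, b n * Real.cos (n * Real.pi * x)| ≤ ε := by
  have hg : ContinuousOn (fun y => w (Real.arccos y / Real.pi)) (Icc (-1) 1) :=
    hw.comp (by fun_prop) fun y _ => arccos_div_pi_mem y
  obtain ⟨q, hq⟩ := exists_polynomial_near_of_continuousOn (-1) 1 _ hg ε hε
  obtain ⟨s, b, hb⟩ := exists_finset_sum_of_mem_span (polynomial_eval_cos_mem_span q)
  refine ⟨s, b, fun x hx => ?_⟩
  rw [← hb, abs_sub_comm]
  have := hq _ (Real.cos_mem_Icc (Real.pi * x))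
  rw [← neumannExt_eq_arccos w x, neumannExt_of_mem hx] at this
  exact this.le

/-! ### Cosine coefficients -/

/-- The cosine coefficients of a function on `[0, 1]`. -/
noncomputable def cosCoeff (w : ℝ → ℝ) (n : ℕ) : ℝ :=
  (if n = 0 then 1 else 2) * ∫ x in (0 : ℝ)..1, w x * Real.cos (n * Real.pi * x)

theorem abs_cosCoeff_le {w : ℝ → ℝ} {M : ℝ} (hM : ∀ x ∈ Icc (0 : ℝ) 1, |w x| ≤ M) (n : ℕ) :
    |cosCoeff w n| ≤ 2 * M := by
  have h : |∫ x in (0 : ℝ)..1, w x * Real.cos (n * Real.pi * x)| ≤ M := by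
    have := norm_integral_le_of_norm_le_const (a := (0 : ℝ)) (b := 1) (C := M)
      (f := fun x => w x * Real.cos (n * Real.pi * x)) fun x hx => by
        rw [uIoc_of_le zero_le_one] at hx
        rw [Real.norm_eq_abs, abs_mul]
        exact (mul_le_of_le_one_right (abs_nonneg _) (Real.abs_cos_le_one _)).trans
          (hM x (Ioc_subset_Icc_self hx))
    simpa using this
  have h0 := (abs_nonneg _).trans h
  rw [cosCoeff, abs_mul]
  refine mul_le_mul ?_ h (abs_nonneg _) zero_le_two
  split_ifs <;> norm_num

theorem cosCoeff_sub {w v : ℝ → ℝ} (hw : ContinuousOn w (Icc 0 1)) (hv : ContinuousOn v (Icc 0 1))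
    (n : ℕ) : cosCoeff (fun x => w x - v x) n = cosCoeff w n - cosCoeff v n := by
  have hi : ∀ f : ℝ → ℝ, ContinuousOn f (Icc 0 1) →
      IntervalIntegrable (fun x => f x * Real.cos (n * Real.pi * x)) volume 0 1 := fun f hf => by
    apply ContinuousOn.intervalIntegrable
    rw [uIcc_of_le zero_le_one]
    fun_prop
  simp only [cosCoeff, sub_mul]
  rw [integral_sub (hi w hw) (hi v hv), mul_sub]

theorem integral_cos_int_mul_pi (k : ℤ) :
    ∫ x in (0 : ℝ)..1, Real.cos (k * Real.pi * x) = if k = 0 then 1 else 0 := by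
  split_ifs with h
  · simp [h]
  · have hk : (k : ℝ) * Real.pi ≠ 0 := mul_ne_zero (by exact_mod_cast h) Real.pi_ne_zero
    rw [integral_comp_mul_left _ hk, integral_cos]
    simp [Real.sin_int_mul_pi]

theorem cosCoeff_sum (s : Finset ℕ) (b : ℕ → ℝ) (m : ℕ) :
    cosCoeff (fun x => ∑ n ∈ s, b n * Real.cos (n * Real.pi * x)) m = if m ∈ s then b m else 0 := by
  have horth : ∀ n : ℕ, ∫ x in (0 : ℝ)..1, Real.cos (n * Real.pi * x) * Real.cos (m * Real.pi * x) =
      if n = m then (if m = 0 then 1 else 1 / 2) else 0 := by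
    intro n
    have e : ∀ x : ℝ, Real.cos (n * Real.pi * x) * Real.cos (m * Real.pi * x) =
        1 / 2 * (Real.cos (((n - m : ℤ) : ℝ) * Real.pi * x) +
          Real.cos (((n + m : ℤ) : ℝ) * Real.pi * x)) := by
      intro x
      push_cast
      rw [show ((n : ℝ) - m) * Real.pi * x = n * Real.pi * x - m * Real.pi * x by ring,
        show ((n : ℝ) + m) * Real.pi * x = n * Real.pi * x + m * Real.pi * x by ring,
        Real.cos_add, Real.cos_sub]
      ring
    simp only [e]
    rw [intervalIntegral.integral_const_mul, integral_add
      (Continuous.intervalIntegrable (by fun_prop) _ _)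
      (Continuous.intervalIntegrable (by fun_prop) _ _), integral_cos_int_mul_pi,
      integral_cos_int_mul_pi]
    have c1 : ((n : ℤ) - m = 0) ↔ n = m := by omega
    have c2 : ((n : ℤ) + m = 0) ↔ n = 0 ∧ m = 0 := by omega
    simp only [c1, c2]
    by_cases h1 : n = m
    · subst h1
      by_cases h2 : n = 0
      · simp [h2]; norm_num
      · simp [h2]
    · have : ¬ (n = 0 ∧ m = 0) := fun h => h1 (h.1.trans h.2.symm)
      simp [h1, this]
  rw [cosCoeff]
  simp only [Finset.sum_mul, mul_assoc (b _)]
  rw [intervalIntegral.integral_finsetSum fun n _ =>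
    Continuous.intervalIntegrable (by fun_prop) _ _]
  simp only [intervalIntegral.integral_const_mul, horth, mul_ite, mul_zero, Finset.sum_ite_eq']
  by_cases h : m ∈ s
  · by_cases h0 : m = 0
    · simp [h0]
    · simp [h, h0]; ring
  · simp [h]

/-! ### The flow -/

theorem natCast_le_mul_pi_rpow {α : ℝ} (h1 : 1 < α) (n : ℕ) : (n : ℝ) ≤ (n * Real.pi) ^ α := by
  rcases Nat.eq_zero_or_pos n with rfl | hn
  · simp [Real.zero_rpow (show α ≠ 0 by linarith)]
  have hn1 : (1 : ℝ) ≤ n := by exact_mod_cast hn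
  have h2 : (n : ℝ) ≤ n * Real.pi := by nlinarith [Real.pi_gt_three]
  exact h2.trans (Real.self_le_rpow_of_one_le (hn1.trans h2) h1.le)

theorem summable_pow_mul_exp {α μ t : ℝ} (h1 : 1 < α) (hμ : 0 < μ) (ht : 0 < t) (k : ℕ) :
    Summable fun n : ℕ => (n : ℝ) ^ k * Real.exp (-(t * μ * (n * Real.pi) ^ α)) := by
  refine Summable.of_nonneg_of_le (fun n => by positivity) (fun n => ?_)
    (Real.summable_pow_mul_exp_neg_nat_mul k (mul_pos ht hμ))
  refine mul_le_mul_of_nonneg_left (Real.exp_le_exp.2 ?_) (by positivity)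
  rw [neg_mul, neg_le_neg_iff]
  exact mul_le_mul_of_nonneg_left (natCast_le_mul_pi_rpow h1 n) (by positivity)

/-- The solution operator, as a cosine series. -/
noncomputable def neumannFlow (α μ : ℝ) (w : ℝ → ℝ) (t x : ℝ) : ℝ :=
  if 0 < t then ∑' n : ℕ, cosCoeff w n * Real.exp (-(t * μ * (n * Real.pi) ^ α)) *
    Real.cos (n * Real.pi * x) else neumannExt w x

theorem summable_flow {α μ t : ℝ} (h1 : 1 < α) (hμ : 0 < μ) (ht : 0 < t) {w : ℝ → ℝ}
    {M : ℝ} (hM : ∀ x ∈ Icc (0 : ℝ) 1, |w x| ≤ M) (x : ℝ) :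
    Summable fun n : ℕ => cosCoeff w n * Real.exp (-(t * μ * (n * Real.pi) ^ α)) *
      Real.cos (n * Real.pi * x) := by
  refine Summable.of_norm_bounded ((summable_pow_mul_exp h1 hμ ht 0).mul_left (2 * M)) fun n => ?_
  rw [Real.norm_eq_abs, abs_mul, abs_mul, Real.abs_exp, pow_zero, one_mul]
  refine (mul_le_of_le_one_right (by positivity) (Real.abs_cos_le_one _)).trans ?_
  exact mul_le_mul_of_nonneg_right (abs_cosCoeff_le hM n) (Real.exp_pos _).le

theorem exists_abs_le_of_continuousOn {w : ℝ → ℝ} (hw : ContinuousOn w (Icc 0 1)) :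
    ∃ M, ∀ x ∈ Icc (0 : ℝ) 1, |w x| ≤ M :=
  isCompact_Icc.exists_bound_of_continuousOn hw

theorem neumannFlow_sub {α μ : ℝ} (h1 : 1 < α) (hμ : 0 < μ) {w v : ℝ → ℝ}
    (hw : ContinuousOn w (Icc 0 1)) (hv : ContinuousOn v (Icc 0 1)) (t x : ℝ) :
    neumannFlow α μ (fun y => w y - v y) t x = neumannFlow α μ w t x - neumannFlow α μ v t x := by
  unfold neumannFlow
  split_ifs with ht
  · obtain ⟨M, hM⟩ := exists_abs_le_of_continuousOn hw
    obtain ⟨N, hN⟩ := exists_abs_le_of_continuousOn hv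
    rw [← (summable_flow h1 hμ ht hM x).tsum_sub (summable_flow h1 hμ ht hN x)]
    simp only [cosCoeff_sub hw hv, sub_mul]
  · rfl

theorem neumannFlow_sum {α μ : ℝ} {t : ℝ} (ht : 0 ≤ t) (s : Finset ℕ) (b : ℕ → ℝ) (x : ℝ) :
    neumannFlow α μ (fun x => ∑ n ∈ s, b n * Real.cos (n * Real.pi * x)) t x =
      ∑ n ∈ s, b n * Real.exp (-(t * μ * (n * Real.pi) ^ α)) * Real.cos (n * Real.pi * x) := by
  unfold neumannFlow
  split_ifs with h
  · rw [tsum_eq_sum (s := s) fun n hn => by simp [cosCoeff_sum, hn]]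
    refine Finset.sum_congr rfl fun n hn => ?_
    simp [cosCoeff_sum, hn]
  · have h0 : t = 0 := le_antisymm (not_lt.1 h) ht
    rw [neumannExt_of_even]
    · simp [h0]
    · intro x; simp
    · intro x
      exact Finset.sum_congr rfl fun n _ => congrArg (b n * ·) (cos_nat_mul_pi_periodic n x)

/-- The flow is a contraction for the maximum norm. -/
theorem abs_neumannFlow_le {α μ : ℝ} (h1 : 1 < α) (h2 : α ≤ 2) (hμ : 0 < μ) {w : ℝ → ℝ}
    (hw : ContinuousOn w (Icc 0 1)) {M : ℝ} (hM : ∀ x ∈ Icc (0 : ℝ) 1, |w x| ≤ M) {t : ℝ}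
    (ht : 0 ≤ t) (x : ℝ) : |neumannFlow α μ w t x| ≤ M := by
  rcases ht.eq_or_lt with rfl | ht
  · obtain ⟨y, hy, hwy, -⟩ := exists_neumannExt_point x
    simpa [neumannFlow, hwy] using hM y hy
  set E := ∑' n : ℕ, Real.exp (-(t * μ * (n * Real.pi) ^ α)) with hE
  have hEs : Summable fun n : ℕ => Real.exp (-(t * μ * (n * Real.pi) ^ α)) := by
    simpa using summable_pow_mul_exp h1 hμ ht 0
  -- The maximum principle handles an approximating cosine polynomial. The error `w - P` is
  -- estimated crudely through its coefficients; `E` depends on `t`, but `t` is fixed while `η → 0`.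
  have key : ∀ η : ℝ, 0 < η → |neumannFlow α μ w t x| ≤ M + η + 2 * η * E := by
    intro η hη
    obtain ⟨s, b, hb⟩ := exists_cos_sum_near hw hη
    set P : ℝ → ℝ := fun x => ∑ n ∈ s, b n * Real.cos (n * Real.pi * x) with hP
    have hPc : ContinuousOn P (Icc 0 1) := Continuous.continuousOn (by fun_prop)
    have hPe : ∀ y, neumannExt P y = P y := neumannExt_of_even (fun x => by simp [hP])
      fun x => Finset.sum_congr rfl fun n _ => congrArg (b n * ·) (cos_nat_mul_pi_periodic n x)
    have hPM : ∀ y, |P y| ≤ M + η := fun y => by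
      obtain ⟨z, hz, hwz, -⟩ := exists_neumannExt_point y
      rw [← hPe, hwz]
      have h3 := abs_sub_abs_le_abs_sub (P z) (w z)
      rw [abs_sub_comm] at h3
      linarith [hb z hz, hM z hz]
    have h3 : |neumannFlow α μ P t x| ≤ M + η := by
      rw [neumannFlow_sum ht.le]
      exact abs_sum_exp_mul_cos_le h1 h2 s b (mul_pos ht hμ).le hPM x
    have h4 : |neumannFlow α μ (fun y => w y - P y) t x| ≤ 2 * η * E := by
      rw [neumannFlow, if_pos ht, hE, ← tsum_mul_left]
      rw [← Real.norm_eq_abs]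
      refine tsum_of_norm_bounded (hEs.mul_left (2 * η)).hasSum fun n => ?_
      rw [Real.norm_eq_abs, abs_mul, abs_mul, Real.abs_exp]
      refine (mul_le_of_le_one_right (by positivity) (Real.abs_cos_le_one _)).trans ?_
      exact mul_le_mul_of_nonneg_right (abs_cosCoeff_le hb n) (Real.exp_pos _).le
    rw [neumannFlow_sub h1 hμ hw hPc] at h4
    have h5 := abs_sub_abs_le_abs_sub (neumannFlow α μ w t x) (neumannFlow α μ P t x)
    linarith
  have hlim : Tendsto (fun η : ℝ => M + η + 2 * η * E) (𝓝[>] 0) (𝓝 (M + 0 + 2 * 0 * E)) := by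
    refine Tendsto.mono_left (Continuous.tendsto ?_ 0) nhdsWithin_le_nhds
    fun_prop
  rw [mul_zero, zero_mul, add_zero, add_zero] at hlim
  exact ge_of_tendsto hlim (eventually_mem_nhdsWithin.mono key)

theorem continuousOn_neumannFlow {α μ : ℝ} (h1 : 1 < α) (h2 : α ≤ 2) (hμ : 0 < μ) {w : ℝ → ℝ}
    (hw : ContinuousOn w (Icc 0 1)) :
    ContinuousOn (Function.uncurry (neumannFlow α μ w)) (Ici 0 ×ˢ univ) := by
  -- By contractivity, uniform approximation of the initial value persists for all times, including
  -- `t = 0`, where the series itself may diverge.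
  refine continuousOn_of_uniform_approx_of_continuousOn fun u hu => ?_
  obtain ⟨ε, hε, hεu⟩ := Metric.mem_uniformity_dist.1 hu
  obtain ⟨s, b, hb⟩ := exists_cos_sum_near hw (half_pos hε)
  refine ⟨fun z => ∑ n ∈ s, b n * Real.exp (-(z.1 * μ * (n * Real.pi) ^ α)) *
    Real.cos (n * Real.pi * z.2), Continuous.continuousOn (by fun_prop), fun z hz => hεu ?_⟩
  have hPc : ContinuousOn (fun x => ∑ n ∈ s, b n * Real.cos (n * Real.pi * x)) (Icc 0 1) :=
    Continuous.continuousOn (by fun_prop)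
  beta_reduce
  rw [← neumannFlow_sum hz.1, Real.dist_eq, Function.uncurry, ← neumannFlow_sub h1 hμ hw hPc]
  exact (abs_neumannFlow_le h1 h2 hμ (hw.sub hPc) hb hz.1 _).trans_lt (half_lt_self hε)

theorem neumannFlow_neg (α μ : ℝ) (w : ℝ → ℝ) (t x : ℝ) :
    neumannFlow α μ w t (-x) = neumannFlow α μ w t x := by
  simp [neumannFlow, neumannExt_neg]

theorem neumannFlow_periodic (α μ : ℝ) (w : ℝ → ℝ) (t : ℝ) :
    Function.Periodic (neumannFlow α μ w t) 2 := fun x => by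
  have h := fun n => cos_nat_mul_pi_periodic n x
  simp only at h
  simp only [neumannFlow, h, neumannExt_periodic w x]

/-! ### Rapidly converging cosine series -/

/-- `b` decays faster than every power. -/
def RapidDecay (b : ℕ → ℝ) : Prop := ∀ k : ℕ, Summable fun n : ℕ => (n : ℝ) ^ k * |b n|

/-- The series of the waves `b n * cos (n π x + θ)`. -/
noncomputable def cosSeries (b : ℕ → ℝ) (θ x : ℝ) : ℝ :=
  ∑' n : ℕ, b n * Real.cos (n * Real.pi * x + θ)

namespace RapidDecay

variable {b : ℕ → ℝ}

theorem of_abs_le (hb : RapidDecay b) {c : ℕ → ℝ} {C : ℝ} (j : ℕ)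
    (h : ∀ n, |c n| ≤ C * ((n : ℝ) ^ j * |b n|)) : RapidDecay c := fun k => by
  refine Summable.of_nonneg_of_le (fun n => by positivity) (fun n => ?_)
    ((hb (k + j)).mul_left C)
  calc (n : ℝ) ^ k * |c n| ≤ (n : ℝ) ^ k * (C * ((n : ℝ) ^ j * |b n|)) := by gcongr; exact h n
    _ = _ := by rw [pow_add]; ring

theorem summable_abs (hb : RapidDecay b) : Summable fun n => |b n| := by simpa using hb 0

theorem freq_mul (hb : RapidDecay b) : RapidDecay fun n => n * Real.pi * b n :=
  hb.of_abs_le (C := Real.pi) 1 fun n => by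
    rw [abs_mul, abs_mul, abs_of_pos Real.pi_pos, Nat.abs_cast, pow_one]
    exact le_of_eq (by ring)

theorem norm_term_le (b : ℕ → ℝ) (θ x : ℝ) (n : ℕ) :
    ‖b n * Real.cos (n * Real.pi * x + θ)‖ ≤ |b n| := by
  rw [Real.norm_eq_abs, abs_mul]
  exact mul_le_of_le_one_right (abs_nonneg _) (Real.abs_cos_le_one _)

theorem summable (hb : RapidDecay b) (θ x : ℝ) :
    Summable fun n => b n * Real.cos (n * Real.pi * x + θ) :=
  Summable.of_norm_bounded hb.summable_abs (norm_term_le b θ x)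

/-- Carrying the phase `θ` as a parameter makes these series closed under differentiation, which is
what the induction in `contDiff` needs. -/
theorem hasDerivAt (hb : RapidDecay b) (θ x : ℝ) :
    HasDerivAt (cosSeries b θ) (cosSeries (fun n => n * Real.pi * b n) (θ + Real.pi / 2) x) x := by
  refine hasDerivAt_tsum (g := fun (n : ℕ) x => b n * Real.cos (n * Real.pi * x + θ))
    (g' := fun (n : ℕ) x => n * Real.pi * b n * Real.cos (n * Real.pi * x + (θ + Real.pi / 2)))
    (y₀ := 0) hb.freq_mul.summable_abs (fun n y => ?_)
    (fun n y => norm_term_le (fun n => n * Real.pi * b n) (θ + Real.pi / 2) y n)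
    (hb.summable θ 0) x
  have h1 : HasDerivAt (fun y : ℝ => n * Real.pi * y + θ) (n * Real.pi) y := by
    simpa using ((hasDerivAt_id y).const_mul (n * Real.pi)).add_const θ
  refine (h1.cos.const_mul (b n)).congr_deriv ?_
  rw [← add_assoc, Real.cos_add_pi_div_two]
  ring

theorem continuous (hb : RapidDecay b) (θ : ℝ) : Continuous (cosSeries b θ) :=
  continuous_iff_continuousAt.2 fun x => (hb.hasDerivAt θ x).continuousAt

theorem contDiff (hb : RapidDecay b) (θ : ℝ) : ContDiff ℝ ∞ (cosSeries b θ) := by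
  rw [contDiff_infty]
  intro m
  induction m generalizing b θ with
  | zero => exact contDiff_zero.2 (hb.continuous θ)
  | succ m ih =>
    rw [Nat.cast_succ, contDiff_succ_iff_deriv]
    refine ⟨fun x => (hb.hasDerivAt θ x).differentiableAt, by simp, ?_⟩
    rw [show deriv (cosSeries b θ) = cosSeries (fun n => n * Real.pi * b n) (θ + Real.pi / 2) from
      funext fun x => (hb.hasDerivAt θ x).deriv]
    exact ih hb.freq_mul _

theorem hasSecondDerivAt (hb : RapidDecay b) (θ x : ℝ) :
    HasSecondDerivAt (cosSeries b θ)
      (-cosSeries (fun n => (n * Real.pi) ^ 2 * b n) θ x) x := by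
  refine ⟨_, Eventually.of_forall fun y => hb.hasDerivAt θ y, ?_⟩
  refine (hb.freq_mul.hasDerivAt (θ + Real.pi / 2) x).congr_deriv ?_
  simp only [cosSeries]
  rw [← tsum_neg]
  refine tsum_congr fun n => ?_
  rw [show n * Real.pi * x + (θ + Real.pi / 2 + Real.pi / 2) = n * Real.pi * x + θ + Real.pi by ring,
    Real.cos_add_pi]
  ring

end RapidDecay

theorem cosSeries_periodic (b : ℕ → ℝ) (θ : ℝ) : Function.Periodic (cosSeries b θ) 2 := fun x => by
  refine tsum_congr fun n => ?_
  rw [show n * Real.pi * (x + 2) + θ = n * Real.pi * x + θ + n * (2 * Real.pi) by ring,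
    Real.cos_add_nat_mul_two_pi]

theorem cosSeries_neg (b : ℕ → ℝ) (θ x : ℝ) : cosSeries b θ (-x) = cosSeries b (-θ) x := by
  refine tsum_congr fun n => ?_
  rw [← Real.cos_neg]
  ring_nf

/-- Without a constant term the series has a periodic primitive, with coefficients `b n / (n * π)`
and phase `-π / 2`, so its mean vanishes. -/
theorem RapidDecay.memCI {b : ℕ → ℝ} (hb : RapidDecay b) (h0 : b 0 = 0) :
    MemCI (cosSeries b 0) := by
  refine ⟨0, 2, two_pos, by simpa using cosSeries_periodic b 0, cosSeries b 0,
    (hb.continuous 0).continuousOn, fun x _ => rfl, ?_, ?_⟩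
  · have := cosSeries_periodic b 0 0
    rw [zero_add] at this
    rw [this]; ring
  · have hc : RapidDecay fun n => b n / (n * Real.pi) := by
      refine hb.of_abs_le (C := 1) 0 fun n => ?_
      rw [pow_zero, one_mul, one_mul, abs_div]
      rcases Nat.eq_zero_or_pos n with rfl | hn
      · simp
      refine div_le_self (abs_nonneg _) ?_
      have : (1 : ℝ) ≤ n := by exact_mod_cast hn
      rw [abs_of_nonneg (by positivity)]
      nlinarith [Real.pi_gt_three]
    have hd := hc.hasDerivAt (-(Real.pi / 2))
    have e : (fun n : ℕ => n * Real.pi * (b n / (n * Real.pi))) = b := by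
      funext n
      rcases Nat.eq_zero_or_pos n with rfl | hn
      · simp [h0]
      · have := Real.pi_pos
        field_simp
    simp only [e, neg_add_cancel] at hd
    rw [integral_eq_sub_of_hasDerivAt (fun x _ => hd x)
      ((hb.continuous 0).intervalIntegrable _ _)]
    have := cosSeries_periodic (fun n => b n / (n * Real.pi)) (-(Real.pi / 2)) 0
    rw [zero_add] at this
    rw [this, sub_self]

/-- Sum and integral are interchanged for finite `R`; then `R → ∞` under the sum by Tannery's
theorem. For `0 < β` the condition `b 0 = 0` excludes a constant, whose integral would diverge. -/
theorem RapidDecay.hasLeftFracIntegral {b : ℕ → ℝ} (hb : RapidDecay b) (h0 : b 0 = 0)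
    {β ρ θ : ℝ} (hβ : 0 ≤ β) (hβ1 : β < 1) (hm : IsFracMultiplier β ρ θ) (φ x : ℝ) :
    HasLeftFracIntegral β (cosSeries b φ) x
      (cosSeries (fun n => ρ * (n * Real.pi) ^ (-β) * b n) (φ - θ) x) := by
  have hpi := Real.pi_pos
  rcases hβ.eq_or_lt with rfl | hβ
  · refine Or.inl ⟨rfl, tsum_congr fun n => ?_⟩
    rcases Nat.eq_zero_or_pos n with rfl | hn
    · simp [h0]
    have := hm (n * Real.pi) (by positivity) φ x
    simp only [HasLeftFracIntegral, lt_irrefl, false_and, or_false, true_and] at this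
    rw [← add_sub_assoc, ← this]
    ring
  rw [hasLeftFracIntegral_iff hβ]
  have hΓ := Real.Gamma_pos_of_pos hβ
  have hswap : ∀ R : ℝ, 0 ≤ R →
      HasSum (fun n : ℕ => b n * (1 / Real.Gamma β *
        ∫ s in (0 : ℝ)..R, Real.cos (n * Real.pi * (x - s) + φ) / s ^ (1 - β)))
      (1 / Real.Gamma β * ∫ s in (0 : ℝ)..R, cosSeries b φ (x - s) / s ^ (1 - β)) := by
    intro R hR
    have h1 : HasSum (fun n : ℕ => ∫ s in (0 : ℝ)..R,
        b n * Real.cos (n * Real.pi * (x - s) + φ) / s ^ (1 - β))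
        (∫ s in (0 : ℝ)..R, cosSeries b φ (x - s) / s ^ (1 - β)) := by
      refine hasSum_integral_of_dominated_convergence
        (fun n s => |b n| * (s ^ (1 - β))⁻¹) (fun n => ?_) (fun n => ?_) ?_ ?_ ?_
      · exact Measurable.aestronglyMeasurable (by fun_prop)
      · refine Eventually.of_forall fun s hs => ?_
        rw [uIoc_of_le hR] at hs
        rw [norm_div, div_eq_mul_inv, Real.norm_of_nonneg (Real.rpow_nonneg hs.1.le _)]
        exact mul_le_mul_of_nonneg_right (RapidDecay.norm_term_le b φ _ n)
          (inv_nonneg.2 (Real.rpow_nonneg hs.1.le _))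
      · exact Eventually.of_forall fun s _ => hb.summable_abs.mul_right _
      · simp only [tsum_mul_right]
        exact (intervalIntegrable_inv_rpow hβ le_rfl hR).const_mul _
      · exact Eventually.of_forall fun s _ => (hb.summable φ (x - s)).hasSum.div_const _
    refine (h1.mul_left (1 / Real.Gamma β)).congr_fun fun n => ?_
    rw [mul_left_comm, ← intervalIntegral.integral_const_mul]
    simp only [mul_div_assoc]
  have hlim : Tendsto (fun R => ∑' n : ℕ, b n * (1 / Real.Gamma β *
        ∫ s in (0 : ℝ)..R, Real.cos (n * Real.pi * (x - s) + φ) / s ^ (1 - β))) atTop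
      (𝓝 (cosSeries (fun n => ρ * (n * Real.pi) ^ (-β) * b n) (φ - θ) x)) := by
    -- Waves are bounded by `1`, and for frequency at least `1` their primitives by `2`; hence `1 /
    -- β + 2`, uniformly in `R` and `n`.
    refine tendsto_tsum_of_dominated_convergence
      (bound := fun n => |b n| * (1 / Real.Gamma β * (1 / β + 2)))
      (hb.summable_abs.mul_right _) (fun n => ?_) ?_
    · rcases Nat.eq_zero_or_pos n with rfl | hn
      · simp [h0]
      have h1 := (hasLeftFracIntegral_iff hβ).1 (hm (n * Real.pi) (by positivity) φ x)
      rw [show ρ * (n * Real.pi) ^ (-β) * b n * Real.cos (n * Real.pi * x + (φ - θ)) =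
        b n * (ρ * (n * Real.pi) ^ (-β) * Real.cos (n * Real.pi * x + φ - θ)) by
          rw [← add_sub_assoc]; ring]
      exact h1.const_mul (b n)
    · filter_upwards [eventually_ge_atTop 0] with R hR n
      rcases Nat.eq_zero_or_pos n with rfl | hn
      · simp [h0]
      have hn1 : (1 : ℝ) ≤ n := by exact_mod_cast hn
      have hν : 1 ≤ n * Real.pi := by nlinarith [Real.pi_gt_three]
      rw [Real.norm_eq_abs, abs_mul, abs_mul, abs_of_pos (show 0 < 1 / Real.Gamma β by positivity)]
      gcongr
      refine abs_integral_zero_div_rpow_le hβ hβ1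
        (f := fun s => Real.cos (n * Real.pi * (x - s) + φ)) (by fun_prop)
        (fun s => Real.abs_cos_le_one _) hR fun r s => ?_
      have e : ∀ y, Real.cos (n * Real.pi * (x - y) + φ) =
          Real.cos (n * Real.pi * y + -(n * Real.pi * x + φ)) := fun y => by
        rw [← Real.cos_neg]; ring_nf
      simp only [e]
      exact (abs_integral_cos_le (by linarith) _ r s).trans (div_le_self zero_le_two hν)
  refine hlim.congr' ?_
  filter_upwards [eventually_ge_atTop 0] with R hR
  exact (hswap R hR).tsum_eq

/-- The constant mode `b 0` plays the role of `c`. The opposite phases `-θ` and `θ` of the two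
integrals again add up to `2 * cos θ`. -/
theorem RapidDecay.hasRieszDerivAt {b : ℕ → ℝ} (hb : RapidDecay b) {α σ ρ θ : ℝ}
    (h1 : 1 < α) (h2 : α ≤ 2) (hm : IsFracMultiplier (2 - α) ρ θ) (x : ℝ) :
    HasRieszDerivAt α σ (cosSeries b 0)
      (cosSeries (fun n => b n * -(rieszSpeed α σ ρ θ * (n * Real.pi) ^ α)) 0 x) x := by
  have hpi := Real.pi_pos
  have hcos := cos_mul_pi_div_two_neg h1 h2
  have hβ : 0 ≤ 2 - α := by linarith
  have hβ1 : 2 - α < 1 := by linarith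
  set b' : ℕ → ℝ := fun n => if n = 0 then 0 else b n with hb'
  have hb'd : RapidDecay b' := hb.of_abs_le (C := 1) 0 fun n => by
    by_cases h : n = 0 <;> simp [hb', h]
  have hb'0 : b' 0 = 0 := if_pos rfl
  set c : ℕ → ℝ := fun n => ρ * (n * Real.pi) ^ (-(2 - α)) * b' n with hc
  have hcd : RapidDecay c := hb'd.of_abs_le (C := |ρ|) 0 fun n => by
    rw [pow_zero, one_mul, hc, abs_mul, abs_mul]
    gcongr
    refine mul_le_of_le_one_right (abs_nonneg _) ?_
    -- At `n = 0` the power is `0 ^ (-(2 - α))`, which is `1` for `α = 2` and `0` otherwise by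
    -- convention.
    rcases Nat.eq_zero_or_pos n with rfl | hn
    · rcases hβ.eq_or_lt with h | h
      · simp [← h]
      · rw [Nat.cast_zero, zero_mul, Real.zero_rpow (by linarith)]; simp
    have hn1 : (1 : ℝ) ≤ n := by exact_mod_cast hn
    rw [abs_of_nonneg (by positivity)]
    exact Real.rpow_le_one_of_one_le_of_nonpos (by nlinarith [Real.pi_gt_three]) (by linarith)
  have hsplit : ∀ y, cosSeries b 0 y = cosSeries b' 0 y + b 0 := by
    intro y
    have h3 := hb.summable 0 y
    have h4 := hb'd.summable 0 y
    rw [cosSeries, cosSeries, h3.tsum_eq_zero_add, h4.tsum_eq_zero_add]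
    simp [hb'0]
    rw [add_comm]
    simp [hb']
  refine ⟨cosSeries b' 0, b 0, hb'd.memCI hb'0, hsplit,
    -cosSeries (fun n => (n * Real.pi) ^ 2 * c n) (0 - θ) x,
    -cosSeries (fun n => (n * Real.pi) ^ 2 * c n) θ x, ?_, ?_, ?_⟩
  · exact ⟨cosSeries c (0 - θ), fun y => hb'd.hasLeftFracIntegral hb'0 hβ hβ1 hm 0 y,
      hcd.hasSecondDerivAt _ x⟩
  · refine ⟨cosSeries c θ, fun y => ?_, hcd.hasSecondDerivAt _ x⟩
    rw [hasRightFracIntegral_iff_left hβ]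
    have h3 := hb'd.hasLeftFracIntegral hb'0 hβ hβ1 hm 0 (-y)
    rw [cosSeries_neg, zero_sub, neg_neg] at h3
    have h4 : (fun y => cosSeries b' 0 (-y)) = cosSeries b' 0 := funext fun y => by
      rw [cosSeries_neg, neg_zero]
    rwa [h4]
  · have hs : ∀ ψ, Summable fun n : ℕ => (n * Real.pi) ^ 2 * c n *
        Real.cos (n * Real.pi * x + ψ) := fun ψ => by
      have h3 := hcd.freq_mul.freq_mul.summable ψ x
      refine h3.congr fun n => ?_
      ring
    rw [← neg_add, cosSeries, cosSeries, cosSeries, ← (hs _).tsum_add (hs _), ← tsum_neg,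
      ← tsum_mul_left]
    refine tsum_congr fun n => ?_
    rcases Nat.eq_zero_or_pos n with rfl | hn
    · simp [Real.zero_rpow (show α ≠ 0 by linarith)]
    have hν : 0 < n * Real.pi := by positivity
    have h4 : (n * Real.pi) ^ 2 * (n * Real.pi) ^ (-(2 - α)) = (n * Real.pi) ^ α := by
      rw [← Real.rpow_natCast, ← Real.rpow_add hν]; norm_num
    have h5 : b' n = b n := if_neg hn.ne'
    have hcn : (n * Real.pi) ^ 2 * c n = ρ * (n * Real.pi) ^ α * b n := by
      rw [← h4, hc]
      simp only [h5]
      ring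
    rw [hcn, rieszSpeed, zero_sub, ← sub_eq_add_neg, add_zero, Real.cos_sub,
      Real.cos_add]
    have := hcos.ne
    generalize Real.cos (α * (Real.pi / 2)) = C at *
    field_simp
    ring

/-! ### The flow solves the equation -/

theorem mul_pi_rpow_le {α : ℝ} (h1 : 1 < α) (h2 : α ≤ 2) (n : ℕ) :
    (n * Real.pi) ^ α ≤ Real.pi ^ 2 * (n : ℝ) ^ 2 := by
  rcases Nat.eq_zero_or_pos n with rfl | hn
  · simp [Real.zero_rpow (show α ≠ 0 by linarith)]
  have hn1 : (1 : ℝ) ≤ n := by exact_mod_cast hn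
  have h3 : 1 ≤ n * Real.pi := by nlinarith [Real.pi_gt_three]
  refine (Real.rpow_le_rpow_of_exponent_le h3 h2).trans ?_
  rw [Real.rpow_two]
  exact le_of_eq (by ring)

/-- The time derivative of the flow. -/
noncomputable def neumannFlowDeriv (α μ : ℝ) (w : ℝ → ℝ) (t x : ℝ) : ℝ :=
  cosSeries (fun n => cosCoeff w n * Real.exp (-(t * μ * (n * Real.pi) ^ α)) *
    -(μ * (n * Real.pi) ^ α)) 0 x

theorem neumannFlow_eq_cosSeries {α μ : ℝ} (w : ℝ → ℝ) {t : ℝ} (ht : 0 < t) :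
    neumannFlow α μ w t =
      cosSeries (fun n => cosCoeff w n * Real.exp (-(t * μ * (n * Real.pi) ^ α))) 0 := by
  funext x
  simp [neumannFlow, ht, cosSeries]

section

variable {α μ : ℝ} {w : ℝ → ℝ}

theorem rapidDecay_flow (h1 : 1 < α) (hμ : 0 < μ) (hw : ContinuousOn w (Icc 0 1)) {t : ℝ}
    (ht : 0 < t) :
    RapidDecay fun n => cosCoeff w n * Real.exp (-(t * μ * (n * Real.pi) ^ α)) := fun k => by
  obtain ⟨M, hM⟩ := exists_abs_le_of_continuousOn hw
  refine Summable.of_nonneg_of_le (fun n => by positivity) (fun n => ?_)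
    ((summable_pow_mul_exp h1 hμ ht k).mul_left (2 * M))
  rw [abs_mul, Real.abs_exp, mul_left_comm]
  exact mul_le_mul_of_nonneg_right (abs_cosCoeff_le hM n) (by positivity)

theorem norm_flowDeriv_term_le (h1 : 1 < α) (h2 : α ≤ 2) (hμ : 0 < μ) {M : ℝ}
    (hM : ∀ x ∈ Icc (0 : ℝ) 1, |w x| ≤ M) {a t : ℝ} (hat : a ≤ t) (n : ℕ) (x : ℝ) :
    ‖cosCoeff w n * Real.exp (-(t * μ * (n * Real.pi) ^ α)) * -(μ * (n * Real.pi) ^ α) *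
      Real.cos (n * Real.pi * x + 0)‖ ≤
      2 * M * μ * Real.pi ^ 2 * ((n : ℝ) ^ 2 * Real.exp (-(a * μ * (n * Real.pi) ^ α))) := by
  have hpi := Real.pi_pos
  have h0 : 0 ≤ (n * Real.pi) ^ α := by positivity
  have hM0 : 0 ≤ M := (abs_nonneg _).trans (hM 0 ⟨le_rfl, zero_le_one⟩)
  rw [norm_mul, norm_mul, norm_mul, norm_neg]
  simp only [Real.norm_eq_abs]
  rw [Real.abs_exp, abs_of_nonneg (mul_nonneg hμ.le h0)]
  calc _ ≤ 2 * M * Real.exp (-(a * μ * (n * Real.pi) ^ α)) *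
        (μ * (Real.pi ^ 2 * (n : ℝ) ^ 2)) * 1 := by
        gcongr
        · exact abs_cosCoeff_le hM n
        · exact mul_pi_rpow_le h1 h2 n
        · exact Real.abs_cos_le_one _
    _ = _ := by ring

theorem continuousOn_neumannFlowDeriv (h1 : 1 < α) (h2 : α ≤ 2) (hμ : 0 < μ)
    (hw : ContinuousOn w (Icc 0 1)) :
    ContinuousOn (Function.uncurry (neumannFlowDeriv α μ w)) (Ioi 0 ×ˢ univ) := by
  obtain ⟨M, hM⟩ := exists_abs_le_of_continuousOn hw
  intro z hz
  -- The series converges uniformly only away from `t = 0`; continuity is local, so a half-plane `t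
  -- > a > 0` suffices.
  obtain ⟨a, ha0, haz⟩ := exists_between (mem_Ioi.1 hz.1)
  have hc : ContinuousOn (Function.uncurry (neumannFlowDeriv α μ w)) (Ioi a ×ˢ univ) := by
    refine continuousOn_tsum (f := fun (n : ℕ) (z : ℝ × ℝ) => cosCoeff w n *
      Real.exp (-(z.1 * μ * (n * Real.pi) ^ α)) * -(μ * (n * Real.pi) ^ α) *
      Real.cos (n * Real.pi * z.2 + 0)) (fun n => Continuous.continuousOn (by fun_prop))
      ((summable_pow_mul_exp h1 hμ ha0 2).mul_left (2 * M * μ * Real.pi ^ 2))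
      fun n y hy => norm_flowDeriv_term_le h1 h2 hμ hM (mem_Ioi.1 hy.1).le n y.2
  exact (hc.continuousAt ((isOpen_Ioi.prod isOpen_univ).mem_nhds ⟨haz, trivial⟩)
    ).continuousWithinAt

theorem hasDerivAt_neumannFlow (h1 : 1 < α) (h2 : α ≤ 2) (hμ : 0 < μ)
    (hw : ContinuousOn w (Icc 0 1)) {t : ℝ} (ht : 0 < t) (x : ℝ) :
    HasDerivAt (fun s => neumannFlow α μ w s x) (neumannFlowDeriv α μ w t x) t := by
  obtain ⟨M, hM⟩ := exists_abs_le_of_continuousOn hw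
  obtain ⟨a, ha0, hat⟩ := exists_between ht
  have hd : HasDerivAt (fun s => ∑' n : ℕ, cosCoeff w n *
      Real.exp (-(s * μ * (n * Real.pi) ^ α)) * Real.cos (n * Real.pi * x + 0))
      (neumannFlowDeriv α μ w t x) t := by
    refine hasDerivAt_tsum_of_isPreconnected (t := Ioi a) (y₀ := t)
      (g := fun (n : ℕ) s => cosCoeff w n * Real.exp (-(s * μ * (n * Real.pi) ^ α)) *
        Real.cos (n * Real.pi * x + 0))
      (g' := fun (n : ℕ) s => cosCoeff w n * Real.exp (-(s * μ * (n * Real.pi) ^ α)) *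
        -(μ * (n * Real.pi) ^ α) * Real.cos (n * Real.pi * x + 0))
      ((summable_pow_mul_exp h1 hμ ha0 2).mul_left (2 * M * μ * Real.pi ^ 2)) isOpen_Ioi
      isPreconnected_Ioi (fun n s _ => ?_)
      (fun n s hs => norm_flowDeriv_term_le h1 h2 hμ hM (mem_Ioi.1 hs).le n x) hat
      ((rapidDecay_flow h1 hμ hw ht).summable 0 x) hat
    have h3 : HasDerivAt (fun s : ℝ => -(s * μ * (n * Real.pi) ^ α))
        (-(μ * (n * Real.pi) ^ α)) s := by
      have h4 := ((hasDerivAt_id s).mul_const (-(μ * (n * Real.pi) ^ α)))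
      refine (h4.congr_deriv (one_mul _)).congr_of_eventuallyEq (Eventually.of_forall fun r => ?_)
      simp only [id]
      ring
    refine ((h3.exp.const_mul (cosCoeff w n)).mul_const _).congr_deriv ?_
    ring
  refine hd.congr_of_eventuallyEq ?_
  filter_upwards [Ioi_mem_nhds ht] with s hs
  rw [neumannFlow_eq_cosSeries w hs, cosSeries]

/-- Shifting the datum by its period `p` multiplies its `n`-th cosine coefficient by `cos (n * π *
p)`, since the sine coefficient vanishes by evenness. So each mode is either absent or itself
`p`-periodic. -/
theorem neumannFlow_periodic_of_periodic (hw : ContinuousOn w (Icc 0 1)) {p : ℝ}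
    (hp : Function.Periodic (neumannExt w) p) (t : ℝ) :
    Function.Periodic (neumannFlow α μ w t) p := by
  intro x
  unfold neumannFlow
  split_ifs with ht
  swap
  · exact hp x
  refine tsum_congr fun n => ?_
  have hf := continuous_neumannExt hw
  have hk : n * Real.pi * 2 = ((n : ℤ) : ℝ) * (2 * Real.pi) := by push_cast; ring
  set J := ∫ x in (0 : ℝ)..2, neumannExt w x * Real.cos (n * Real.pi * x + 0) with hJ
  set S := ∫ x in (0 : ℝ)..2, neumannExt w x * Real.sin (n * Real.pi * x + 0) with hS
  have hshift := (neumannExt_periodic w).integral_comp_sub_mul_cos hf hk 0 p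
  simp only [hp.sub_eq, ← hJ, ← hS] at hshift
  have hS0 : S = 0 := by
    have hper : Function.Periodic
        (fun x => neumannExt w x * Real.sin (n * Real.pi * x + 0)) 2 := fun x => by
      simp only
      rw [neumannExt_periodic w x, show n * Real.pi * (x + 2) + 0 =
        n * Real.pi * x + 0 + n * (2 * Real.pi) by ring, Real.sin_add_nat_mul_two_pi]
    have h3 := hper.integral_comp_neg
    simp only [neumannExt_neg, add_zero, mul_neg, Real.sin_neg,
      intervalIntegral.integral_neg] at h3
    rw [hS]
    simp only [add_zero]
    linarith
  have hJw : J = 2 * ∫ x in (0 : ℝ)..1, w x * Real.cos (n * Real.pi * x) := by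
    have hper : Function.Periodic
        (fun x => neumannExt w x * Real.cos (n * Real.pi * x + 0)) 2 :=
      (neumannExt_periodic w).mul (cos_periodic_of_mul_eq hk 0)
    have h3 := hper.intervalIntegral_add_eq 0 (-1)
    have hi : ∀ a b, IntervalIntegrable (fun x => neumannExt w x * Real.cos (n * Real.pi * x + 0))
      volume a b := fun a b => Continuous.intervalIntegrable (by fun_prop) _ _
    rw [zero_add, show (-1 : ℝ) + 2 = 1 by norm_num, ← hJ,
      ← integral_add_adjacent_intervals (hi (-1) 0) (hi 0 1)] at h3
    have h4 := intervalIntegral.integral_comp_neg (a := 0) (b := 1)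
      (fun x => neumannExt w x * Real.cos (n * Real.pi * x + 0))
    simp only [neumannExt_neg, add_zero, mul_neg, Real.cos_neg, neg_zero] at h4
    simp only [add_zero] at h3
    rw [h3, ← h4, ← two_mul]
    congr 1
    refine integral_congr fun x hx => ?_
    rw [uIcc_of_le zero_le_one] at hx
    simp only [neumannExt_of_mem hx]
  rw [hS0, zero_mul, sub_zero] at hshift
  have h5 : J = 0 ∨ Real.cos (n * Real.pi * p) = 1 := by
    by_cases hJ0 : J = 0
    · exact Or.inl hJ0
    · exact Or.inr (mul_left_cancel₀ hJ0 (by rw [← hshift, mul_one]))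
  rcases h5 with h5 | h5
  · have : cosCoeff w n = 0 := by
      rw [cosCoeff, (mul_eq_zero.1 (hJw ▸ h5 :
        2 * ∫ x in (0 : ℝ)..1, w x * Real.cos (n * Real.pi * x) = 0)).resolve_left two_ne_zero,
        mul_zero]
    rw [this]
    simp
  · have h6 : Real.sin (n * Real.pi * p) = 0 := by
      have := Real.sin_sq_add_cos_sq (n * Real.pi * p)
      rw [h5] at this
      exact pow_eq_zero_iff two_ne_zero |>.1 (by linarith)
    rw [mul_add, Real.cos_add, h5, h6]
    ring

theorem hasRieszDerivAt_neumannFlow {σ ρ θ : ℝ} (h1 : 1 < α) (h2 : α ≤ 2)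
    (hμ : 0 < rieszSpeed α σ ρ θ) (hm : IsFracMultiplier (2 - α) ρ θ)
    (hw : ContinuousOn w (Icc 0 1)) {t : ℝ} (ht : 0 < t) (x : ℝ) :
    HasRieszDerivAt α σ (neumannFlow α (rieszSpeed α σ ρ θ) w t)
      (neumannFlowDeriv α (rieszSpeed α σ ρ θ) w t x) x := by
  rw [neumannFlow_eq_cosSeries w ht]
  exact (rapidDecay_flow h1 hμ hw ht).hasRieszDerivAt h1 h2 hm x

theorem isCauchySolution_neumannFlow {σ ρ θ T : ℝ} (h1 : 1 < α) (h2 : α ≤ 2)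
    (hμ : 0 < rieszSpeed α σ ρ θ) (hm : IsFracMultiplier (2 - α) ρ θ)
    (hw : ContinuousOn w (Icc 0 1)) :
    IsCauchySolution α σ T (neumannExt w) (neumannFlow α (rieszSpeed α σ ρ θ) w) where
  periodic := ⟨2, two_pos, fun t _ => neumannFlow_periodic _ _ _ t⟩
  continuousOn := (continuousOn_neumannFlow h1 h2 hμ hw).mono
    (prod_mono (fun _ ht => ht.1) subset_rfl)
  equation := ⟨neumannFlowDeriv α (rieszSpeed α σ ρ θ) w,
    (continuousOn_neumannFlowDeriv h1 h2 hμ hw).mono (prod_mono (fun _ ht => ht.1) subset_rfl),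
    fun _ ht x => ⟨hasRieszDerivAt_neumannFlow h1 h2 hμ hm hw ht.1 x,
      hasDerivAt_neumannFlow h1 h2 hμ hw ht.1 x⟩⟩
  initial := fun x => by simp [neumannFlow]

theorem neumannExt_neumannFlow (t : ℝ) :
    neumannExt (neumannFlow α μ w t) = neumannFlow α μ w t :=
  funext fun x => neumannExt_of_even (neumannFlow_neg α μ w t) (neumannFlow_periodic α μ w t) x

end

/-! ### Solutions as periodic evolutions -/

theorem IsCauchySolution.isPeriodicEvolution {α σ T p : ℝ} {w : ℝ → ℝ} {U : ℝ → ℝ → ℝ}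
    (h : IsCauchySolution α σ T w U) (hp : 0 < p)
    (hper : ∀ t ∈ Ico 0 T, Function.Periodic (U t) p) :
    ∃ D, IsPeriodicEvolution α σ T p U D := by
  obtain ⟨D, hD, heq⟩ := h.equation
  exact ⟨D, hp, hper, h.continuousOn, hD, fun t ht x => (heq t ht x).1,
    fun t ht x _ => (heq t ht x).2⟩

/-- Every non-integer point is carried into `(0, 1)` by reflection and translation by even integers.
The extension is invariant under these, and so is `D`, by `periodic_second` and `even_second`. -/
theorem IsNeumannSolution.exists_evolution {α σ T : ℝ} (hα1 : 1 < α) (hα2 : α ≤ 2) (hσ : 0 < σ)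
    {v₀ : ℝ → ℝ} {v : ℝ → ℝ → ℝ} (h : IsNeumannSolution α σ T v₀ v) :
    ∃ D, IsPeriodicEvolution α σ T 2 (fun t => neumannExt (v t)) D := by
  obtain ⟨D, hD, hR, ht'⟩ := h.equation
  have hcW := continuousOn_neumannExt h.continuousOn
  refine ⟨D, two_pos, fun t _ => neumannExt_periodic _, hcW, hD, hR, fun t ht x hx => ?_⟩
  obtain ⟨y, hy, hw, k, hk⟩ := exists_neumannExt_point x
  have hy' : y ∈ Ioo (0 : ℝ) 1 := by
    have hint : ∀ m : ℤ, y ≠ m := by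
      rintro m rfl
      rcases hk with rfl | rfl
      · exact hx ⟨m + k * 2, by push_cast; ring⟩
      · exact hx ⟨-m + k * 2, by push_cast; ring⟩
    exact ⟨lt_of_le_of_ne hy.1 fun h => hint 0 (by simp [← h]),
      lt_of_le_of_ne hy.2 fun h => hint 1 (by simp [h])⟩
  have hcos := cos_mul_pi_div_two_neg hα1 hα2
  obtain ⟨c, f₀, Il, Ir, H', hfc, hpot⟩ := exists_isFracPotential hσ hα2 hcos
    (continuous_slice hcW ⟨ht.1.le, ht.2⟩) (hR t ht)
  have hκ : -(2 * Real.cos (α * (Real.pi / 2)) / σ) ≠ 0 :=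
    neg_ne_zero.2 (div_ne_zero (mul_ne_zero two_ne_zero hcos.ne) hσ.ne')
  have hβ : 0 ≤ 2 - α := by linarith
  have hdp : Function.Periodic (D t) 2 := hpot.periodic_second hβ hκ fun z => by
    linarith [hfc z, hfc (z + 2), neumannExt_periodic (v t) z]
  have hde := hpot.even_second hβ hκ fun z => by
    linarith [hfc z, hfc (-z), neumannExt_neg (v t) z]
  have hDy : D t x = D t y := by
    rcases hk with rfl | rfl
    · exact hdp.int_mul k y
    · rw [hdp.int_mul k (-y), hde]
  rw [hDy]
  simp only [hw]
  exact ht' t ht y hy'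

theorem IsNeumannSolution.eq_neumannFlow {α σ T ρ θ : ℝ} (h1 : 1 < α) (h2 : α ≤ 2) (hσ : 0 < σ)
    (hμ : 0 < rieszSpeed α σ ρ θ) (hm : IsFracMultiplier (2 - α) ρ θ) {v₀ : ℝ → ℝ}
    {v : ℝ → ℝ → ℝ} (hv₀ : ContinuousOn v₀ (Icc 0 1)) (h : IsNeumannSolution α σ T v₀ v)
    {t : ℝ} (ht : t ∈ Ico 0 T) {x : ℝ} (hx : x ∈ Icc (0 : ℝ) 1) :
    v t x = neumannFlow α (rieszSpeed α σ ρ θ) v₀ t x := by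
  obtain ⟨D, hD⟩ := h.exists_evolution h1 h2 hσ
  obtain ⟨D', hD'⟩ := (isCauchySolution_neumannFlow (T := T) h1 h2 hμ hm hv₀).isPeriodicEvolution
    two_pos fun t _ => neumannFlow_periodic _ _ _ t
  have := hD.unique h1 h2 hσ hD' (fun z => by
    obtain ⟨y, hy, hw, -⟩ := exists_neumannExt_point z
    simp [neumannFlow, hw, h.initial y hy]) ht x
  rwa [neumannExt_of_mem hx] at this

theorem IsCauchySolution.eq_neumannFlow {α σ T ρ θ : ℝ} (h1 : 1 < α) (h2 : α ≤ 2) (hσ : 0 < σ)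
    (hμ : 0 < rieszSpeed α σ ρ θ) (hm : IsFracMultiplier (2 - α) ρ θ) {w : ℝ → ℝ}
    {V : ℝ → ℝ → ℝ} (hw : ContinuousOn w (Icc 0 1)) (h : IsCauchySolution α σ T (neumannExt w) V)
    {t : ℝ} (ht : t ∈ Ico 0 T) (x : ℝ) :
    V t x = neumannFlow α (rieszSpeed α σ ρ θ) w t x := by
  obtain ⟨p, hp, hper⟩ := h.periodic
  obtain ⟨D, hD⟩ := h.isPeriodicEvolution hp hper
  have hwp : Function.Periodic (neumannExt w) p := by
    rw [← funext h.initial]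
    exact hper 0 ⟨le_rfl, ht.1.trans_lt ht.2⟩
  obtain ⟨D', hD'⟩ := (isCauchySolution_neumannFlow (T := T) h1 h2 hμ hm hw).isPeriodicEvolution
    hp fun t _ => neumannFlow_periodic_of_periodic hw hwp t
  exact hD.unique h1 h2 hσ hD' (fun z => by simp [neumannFlow, h.initial]) ht x

/-- Symmetry about `a` forces the derivative at `a` to equal its negative. An even 2-periodic
function is symmetric about both `0` and `1`. -/
theorem hasDerivWithinAt_zero_of_symm {f : ℝ → ℝ} {a : ℝ} {s : Set ℝ} (hf : Differentiable ℝ f)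
    (h : ∀ x, f (2 * a - x) = f x) : HasDerivWithinAt f 0 s a := by
  have h1 := (hf a).hasDerivAt
  have h2 : HasDerivAt (fun x => f (2 * a - x)) (-deriv f a) a := by
    have h3 : HasDerivAt f (deriv f a) (2 * a - a) := by rwa [show 2 * a - a = a by ring]
    exact h3.comp_const_sub (2 * a) a
  rw [funext h] at h2
  have h0 : deriv f a = 0 := by linarith [h1.unique h2]
  rw [h0] at h1
  exact h1.hasDerivWithinAt

theorem mainTheorem2 (α σ T : ℝ) (hα : 1 < α) (hα' : α ≤ 2) (hσ : 0 < σ) (hT : 0 < T)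
    (u₀ : ℝ → ℝ) (hu₀ : ContinuousOn u₀ (Icc 0 1)) :
    ∃ u : ℝ → ℝ → ℝ,
      -- existence
      IsNeumannSolution α σ T u₀ u ∧
      -- uniqueness
      (∀ v : ℝ → ℝ → ℝ, IsNeumannSolution α σ T u₀ v →
        ∀ t ∈ Ico 0 T, ∀ x ∈ Icc (0 : ℝ) 1, v t x = u t x) ∧
      -- continuous dependence on the initial value in the maximum norm
      (∀ ε > 0, ∃ δ > 0, ∀ v₀ : ℝ → ℝ, ContinuousOn v₀ (Icc 0 1) →
        (∀ x ∈ Icc (0 : ℝ) 1, |v₀ x - u₀ x| ≤ δ) →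
        ∀ v : ℝ → ℝ → ℝ, IsNeumannSolution α σ T v₀ v →
          ∀ t ∈ Ico 0 T, ∀ x ∈ Icc (0 : ℝ) 1, |v t x - u t x| ≤ ε) ∧
      -- smoothness and boundary conditions
      (∀ t ∈ Ioo 0 T, ContDiffOn ℝ ∞ (u t) (Icc 0 1) ∧
        HasDerivWithinAt (u t) 0 (Icc 0 1) 0 ∧ HasDerivWithinAt (u t) 0 (Icc 0 1) 1) ∧
      -- the solution is the restriction of the solution of the Cauchy problem on the line
      (∃ U : ℝ → ℝ → ℝ, IsCauchySolution α σ T (neumannExt u₀) U ∧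
        (∀ V : ℝ → ℝ → ℝ, IsCauchySolution α σ T (neumannExt u₀) V →
          ∀ t ∈ Ico 0 T, ∀ x : ℝ, V t x = U t x) ∧
        (∀ t ∈ Ico 0 T, (∀ x : ℝ, U t (-x) = U t x) ∧ (∀ x : ℝ, U t (x + 2) = U t x)) ∧
        (∀ t ∈ Ico 0 T, ∀ x ∈ Icc (0 : ℝ) 1, u t x = U t x)) := by
  obtain ⟨ρ, θ, hρ, hm⟩ := exists_isFracMultiplier (β := 2 - α) (by linarith) (by linarith)
  have hcos := cos_mul_pi_div_two_neg hα hα'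
  have hμ : 0 < rieszSpeed α σ ρ θ :=
    neg_pos.2 (div_neg_of_pos_of_neg (mul_pos hσ hρ) hcos)
  set U := neumannFlow α (rieszSpeed α σ ρ θ) u₀ with hU
  have hcauchy := isCauchySolution_neumannFlow (T := T) hα hα' hμ hm hu₀
  have hext : ∀ t, neumannExt (U t) = U t := fun t => neumannExt_neumannFlow t
  refine ⟨U, ⟨hcauchy.continuousOn.mono (prod_mono subset_rfl (subset_univ _)), ?_, ?_⟩,
    fun v hv t ht x hx => hv.eq_neumannFlow hα hα' hσ hμ hm hu₀ ht hx, ?_, ?_,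
    U, hcauchy, fun V hV t ht x => hV.eq_neumannFlow hα hα' hσ hμ hm hu₀ ht x,
    fun t _ => ⟨neumannFlow_neg _ _ _ t, neumannFlow_periodic _ _ _ t⟩, fun t _ x _ => rfl⟩
  · obtain ⟨D, hD, hD'⟩ := hcauchy.equation
    refine ⟨D, hD, fun t ht x => ?_, fun t ht x _ => (hD' t ht x).2⟩
    rw [hext]
    exact (hD' t ht x).1
  · intro x hx
    rw [hU, hcauchy.initial x, neumannExt_of_mem hx]
  -- Linearity and contractivity of the flow allow `δ = ε`.
  · refine fun ε hε => ⟨ε, hε, fun v₀ hv₀ hclose v hv t ht x hx => ?_⟩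
    rw [hv.eq_neumannFlow hα hα' hσ hμ hm hv₀ ht hx, hU, ← neumannFlow_sub hα hμ hv₀ hu₀]
    exact abs_neumannFlow_le hα hα' hμ (hv₀.sub hu₀) hclose ht.1 x
  · intro t ht
    have hsm : ContDiff ℝ ∞ (U t) := by
      rw [hU, neumannFlow_eq_cosSeries u₀ ht.1]
      exact (rapidDecay_flow hα hμ hu₀ ht.1).contDiff 0
    have hdiff : Differentiable ℝ (U t) := hsm.differentiable (by simp)
    have heven : ∀ x, U t (-x) = U t x := neumannFlow_neg _ _ _ t
    have hper : Function.Periodic (U t) 2 := neumannFlow_periodic _ _ _ t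
    refine ⟨hsm.contDiffOn, hasDerivWithinAt_zero_of_symm hdiff fun x => ?_,
      hasDerivWithinAt_zero_of_symm hdiff fun x => ?_⟩
    · rw [mul_zero, zero_sub, heven]
    · rw [mul_one, sub_eq_neg_add, hper, heven]
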